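/- All graphs are finite and simple. A total dominating set of a graph $G$ is a set $S\subseteq V(G)$ such that every vertex of $G$ is adjacent to a vertex of $S$; the total domination number $\gamma_t(G)$ is the minimum cardinality of such a set. A graph $G$ is $k$-$\gamma_t$-vertex-critical if $\gamma_t(G)=k$ and $\gamma_t(G-v)<\gamma_t(G)$ for every vertex $v$ that is not adjacent to a vertex of degree one. A pointed graph is a graph with two assigned vertices, Left and Right, whose distance equals the diameter. For pointed graphs $G_1,G_2$, the pointed graph $G_1\bullet G_2$ is obtained from their disjoint union by identifying the vertex Right of $G_1$ with the vertex Left of $G_2$; its Left is the Left of $G_1$ and its Right is the Right of $G_2$. Let $m\ge 2$ and $t\ge 2$ be integers, and let $H$ be a graph with at least four vertices such that $\gamma_t(H)=\gamma_t(\overline H)=2$. The pointed graph $R$ (depending on $m$) is defined as follows. Let $K_{m,m}$ be the complete bipartite graph with sides $\{y_1,y_3,\dots,y_{2m-1}\}$ and $\{y_2,y_4,\dots,y_{2m}\}$, let $F$ be $K_{m,m}$ without the edge $y_1y_{2m}$, and let $\overline F$ be the complement of $F$, with vertices $x_1,\dots,x_{2m}$, where $x_i$ corresponds to $y_i$. Then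 $R$ is obtained from the disjoint union of $\overline F$ and $K_{m,m}$ by joining $x_i$ to $y_j$ for all $i\ne j$ and adding five new vertices $z_1,z_2,z_3$, Left and Right, where Left is adjacent to all $x_i$; $z_1$ to $x_1,\dots,x_{2m-1},y_2,\dots,y_{2m-1}$; $z_2$ to $x_2,\dots,x_{2m},y_2,\dots,y_{2m-1}$; $z_3$ to all $y_i$ and to $z_1$; and Right to all $y_i$ and to $z_2$. The pointed graph $A$ (depending on $H$) is obtained from the disjoint union of $H$ and $\overline H$ by joining every vertex of $H$ to every vertex of $\overline H$ except the corresponding one, and adding a vertex Left adjacent to all of $H$ and a vertex Right adjacent to all of $\overline H$. The pointed graph $Q$ is obtained from two copies $A_1,A_2$ of $A$ by deleting Right from $A_1$ and Left from $A_2$ and joining every neighbour of the deleted vertex of $A_1$ to every neighbour of the deleted vertex of $A_2$; its Left is that of $A_1$ and its Right is that of $A_2$. Put $Q^{(1)}=Q$ and $Q^{(n)}=Q^{(n-1)}\bullet Q$ for $n\ge 2$; $Q^{(0)}$ is a single vertex, so that $R\bullet Q^{(0)}\bullet J=R\bullet J$. The pointed graph $J$ (depending on $t$) is obtained from the disjoint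 union of $J_1=tK_2$, $J_2=\overline{tK_2}$ and $J_3=tK_2$ (on corresponding vertices) by joining every vertex of $J_2$ to every vertex of $J_1$ and of $J_3$ except the corresponding ones, and adding a vertex Left adjacent to all of $J_1$ and a vertex Right adjacent to all of $J_3$. Theorem. For every integer $n\ge 0$, the graph $G=R\bullet Q^{(n)}\bullet J$ is a $(3n+6)$-$\gamma_t$-vertex-critical graph of diameter $5n+7$, and its vertices Left and Right are at distance $5n+7$. Moreover, for every vertex $v$ of $G$, the graph $G-v$ has a total dominating set of size $3n+5$. -/

import Mathlib

/-! ### Total domination -/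

section TotalDomination

variable {V : Type*}

/-- `S` is a total dominating set of `G`: every vertex of `G` is adjacent to a vertex of `S`. -/
def IsTotalDominatingSet (G : SimpleGraph V) (S : Finset V) : Prop :=
  ∀ v, ∃ s ∈ S, G.Adj v s

/-- The total domination number `γ_t(G)`: the least cardinality of a total dominating set of `G`
(and `⊤` if there is none). -/
noncomputable def totalDominationNumber (G : SimpleGraph V) : ℕ∞ :=
  ⨅ (S : Finset V) (_ : IsTotalDominatingSet G S), (S.card : ℕ∞)

/-- The graph `G - v`. -/
abbrev deleteVertex (G : SimpleGraph V) (v : V) : SimpleGraph ↥({v}ᶜ : Set V) :=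
  G.induce ({v}ᶜ : Set V)

/-- A vertex of degree one. -/
def IsLeafVertex (G : SimpleGraph V) (v : V) : Prop :=
  (G.neighborSet v).encard = 1

/-- `G` is `k`-`γ_t`-vertex-critical: `γ_t(G) = k`, and the removal of any vertex that is not
adjacent to a vertex of degree one decreases the total domination number. -/
def IsTotalDominationVertexCritical (G : SimpleGraph V) (k : ℕ) : Prop :=
  totalDominationNumber G = k ∧
    ∀ v, (∀ u, G.Adj v u → ¬ IsLeafVertex G u) →
      totalDominationNumber (deleteVertex G v) < totalDominationNumber G

end TotalDomination

/-! ### Pointed graphs -/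

universe u v

/-- A graph with two assigned vertices `left` and `right`. That they are diametrical is the
predicate `PointedGraph.IsDiametrical`. -/
structure PointedGraph where
  /-- the vertices -/
  V : Type u
  /-- the graph -/
  graph : SimpleGraph V
  /-- the vertex Left -/
  left : V
  /-- the vertex Right -/
  right : V

namespace PointedGraph

/-- Left and Right are at a distance equal to the (finite) diameter. -/
def IsDiametrical (G : PointedGraph.{u}) : Prop :=
  G.graph.Connected ∧ G.graph.dist G.left G.right = G.graph.diam

/-- The vertices of `G₁ • G₂`: those of `G₁` together with those of `G₂` other than Left. The
vertex Right of `G₁` also plays the role of the vertex Left of `G₂`. -/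
abbrev GlueVert (G₁ : PointedGraph.{u}) (G₂ : PointedGraph.{v}) : Type (max u v) :=
  G₁.V ⊕ {w : G₂.V // w ≠ G₂.left}

/-- The adjacency relation of `G₁ • G₂`. -/
def glueAdj (G₁ : PointedGraph.{u}) (G₂ : PointedGraph.{v}) :
    GlueVert G₁ G₂ → GlueVert G₁ G₂ → Prop
  | .inl a, .inl b => G₁.graph.Adj a b
  | .inl a, .inr b => a = G₁.right ∧ G₂.graph.Adj G₂.left b
  | .inr a, .inl b => b = G₁.right ∧ G₂.graph.Adj G₂.left a
  | .inr a, .inr b => G₂.graph.Adj a b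

open Classical in
/-- The pointed graph `G₁ • G₂`, obtained by identifying the vertex Right of `G₁` with the vertex
Left of `G₂`; its Left is that of `G₁` and its Right is that of `G₂`. -/
noncomputable def glue (G₁ : PointedGraph.{u}) (G₂ : PointedGraph.{v}) :
    PointedGraph.{max u v} where
  V := GlueVert G₁ G₂
  graph :=
    { Adj := glueAdj G₁ G₂
      symm := ⟨by
        rintro (a | a) (b | b) h
        · exact G₁.graph.adj_symm h
        · exact h
        · exact h
        · exact G₂.graph.adj_symm h⟩
      loopless := ⟨by
        rintro (a | a) h
        · exact G₁.graph.loopless.irrefl _ h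
        · exact G₂.graph.loopless.irrefl _ h⟩ }
  left := .inl G₁.left
  right := if h : G₂.right = G₂.left then .inl G₁.right else .inr ⟨G₂.right, h⟩

/-- The pointed graph with a single vertex. -/
def point : PointedGraph.{u} where
  V := PUnit
  graph := ⊥
  left := PUnit.unit
  right := PUnit.unit

/-- `G^(1) = G` and `G^(n) = G^(n-1) • G`. Moreover `G^(0)` is the single vertex, the neutral
element of `•`. -/
noncomputable def pow (G : PointedGraph.{u}) : ℕ → PointedGraph.{u}
  | 0 => point
  | 1 => G
  | n + 2 => glue (pow G (n + 1)) G

end PointedGraph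

/-! ### The pointed graph `R`

The indices `1, …, 2m` are shifted to `0, …, 2m - 1`. -/

/-- The complete bipartite graph `K_{m,m}` on `0, …, 2m - 1`, whose two sides are the even and
the odd numbers. -/
def graphK (m : ℕ) : SimpleGraph (Fin (2 * m)) where
  Adj i j := i.val % 2 ≠ j.val % 2
  symm := ⟨fun _ _ h => h.symm⟩
  loopless := ⟨fun _ h => h rfl⟩

/-- `K_{m,m}` without the edge between the first vertex `0` and the last vertex `2m - 1`. -/
def graphF (m : ℕ) : SimpleGraph (Fin (2 * m)) where
  Adj i j := (graphK m).Adj i j ∧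
    ¬ (i.val = 0 ∧ j.val + 1 = 2 * m) ∧ ¬ (j.val = 0 ∧ i.val + 1 = 2 * m)
  symm := ⟨fun _ _ h => ⟨(graphK m).adj_symm h.1, h.2.2, h.2.1⟩⟩
  loopless := ⟨fun _ h => (graphK m).loopless.irrefl _ h.1⟩

/-- The vertices of `R`. -/
inductive RVert (m : ℕ) : Type
  | x (i : Fin (2 * m))
  | y (i : Fin (2 * m))
  | z1
  | z2
  | z3
  | left
  | right

/-- The edges of `R`, each given in at least one direction. -/
def RRel (m : ℕ) : RVert m → RVert m → Prop
  | .x i, .x j => (graphF m)ᶜ.Adj i j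
  | .y i, .y j => (graphK m).Adj i j
  | .x i, .y j => i ≠ j
  | .left, .x _ => True
  | .z1, .x i => i.val + 1 ≠ 2 * m
  | .z1, .y i => i.val ≠ 0 ∧ i.val + 1 ≠ 2 * m
  | .z2, .x i => i.val ≠ 0
  | .z2, .y i => i.val ≠ 0 ∧ i.val + 1 ≠ 2 * m
  | .z3, .y _ => True
  | .z3, .z1 => True
  | .right, .y _ => True
  | .right, .z2 => True
  | _, _ => False

/-- The pointed graph `R`. -/
def graphR (m : ℕ) : PointedGraph.{0} where
  V := RVert m
  graph := SimpleGraph.fromRel (RRel m)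
  left := .left
  right := .right

/-! ### The pointed graph `Q` -/

/-- The vertices of `Q`: Left and the copies of `H` and `Hᶜ` from `A₁`, then the copies of `H`
and `Hᶜ` and Right from `A₂`. -/
inductive QVert (W : Type u) : Type u
  | left
  | x1 (w : W)
  | y1 (w : W)
  | x2 (w : W)
  | y2 (w : W)
  | right

/-- The edges of `Q`, each given in at least one direction. -/
def QRel {W : Type u} (H : SimpleGraph W) : QVert W → QVert W → Prop
  -- the edges of `A₁` without its vertex Right
  | .left, .x1 _ => True
  | .x1 a, .x1 b => H.Adj a b
  | .x1 a, .y1 b => a ≠ b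
  | .y1 a, .y1 b => Hᶜ.Adj a b
  -- every neighbour of Right in `A₁` is joined to every neighbour of Left in `A₂`
  | .y1 _, .x2 _ => True
  -- the edges of `A₂` without its vertex Left
  | .x2 a, .x2 b => H.Adj a b
  | .x2 a, .y2 b => a ≠ b
  | .y2 a, .y2 b => Hᶜ.Adj a b
  | .y2 _, .right => True
  | _, _ => False

/-- The pointed graph `Q` (built from the graph `H`). -/
def graphQ {W : Type u} (H : SimpleGraph W) : PointedGraph.{u} where
  V := QVert W
  graph := SimpleGraph.fromRel (QRel H)
  left := .left
  right := .right

/-! ### The pointed graph `J` -/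

/-- The disjoint union `tK₂` of `t` edges. -/
def graphTK2 (t : ℕ) : SimpleGraph (Fin t × Bool) where
  Adj p q := p.1 = q.1 ∧ p.2 ≠ q.2
  symm := ⟨fun _ _ h => ⟨h.1.symm, h.2.symm⟩⟩
  loopless := ⟨fun _ h => h.2 rfl⟩

/-- The vertices of `J`: Left, those of `J₁`, `J₂`, `J₃`, and Right. -/
inductive JVert (t : ℕ) : Type
  | left
  | j1 (p : Fin t × Bool)
  | j2 (p : Fin t × Bool)
  | j3 (p : Fin t × Bool)
  | right

/-- The edges of `J`, each given in at least one direction. -/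
def JRel (t : ℕ) : JVert t → JVert t → Prop
  | .left, .j1 _ => True
  | .j1 p, .j1 q => (graphTK2 t).Adj p q
  | .j1 p, .j2 q => p ≠ q
  | .j2 p, .j2 q => (graphTK2 t)ᶜ.Adj p q
  | .j2 p, .j3 q => p ≠ q
  | .j3 p, .j3 q => (graphTK2 t).Adj p q
  | .j3 _, .right => True
  | _, _ => False

/-- The pointed graph `J`. -/
def graphJ (t : ℕ) : PointedGraph.{0} where
  V := JVert t
  graph := SimpleGraph.fromRel (JRel t)
  left := .left
  right := .right

/-! ### The pointed graph `R • Q^(n) • J` -/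

/-- The pointed graph `R • Q^(n) • J`. -/
noncomputable def graphRQJ (m : ℕ) {W : Type u} (H : SimpleGraph W) (t n : ℕ) :
    PointedGraph.{u} :=
  PointedGraph.glue (PointedGraph.glue (graphR m) (PointedGraph.pow (graphQ H) n)) (graphJ t)

/-! The vertex at which two pointed graphs are glued is a cut vertex, so a set of vertices of the
chain splits there, and the two sides interact only through two questions: is the cut vertex in the
set, and which side dominates it? Everything is bookkeeping of these states.

A prefix `R • Q^(k)` needs `3k + 2` vertices to dominate all but Right, and `3k + 3` as soon as the
set contains or dominates Right. A link `Q` adds at least 2 vertices beyond Left, one more if it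
must dominate Left without containing it, and one more if it contains or dominates Right. The end
`J` adds 3, or 4 if it must dominate Left without containing it. So the extra unit for a cut vertex
is paid on one side or the other, which gives the lower bound `(3n + 3) + 3 = (3n + 2) + 4 = 3n +
6`. After deletion of a vertex, the piece containing it has a cheaper set, and sets of matching
states on the other pieces bring the total to `3n + 5`. Adding a neighbour of the deleted vertex
yields a total dominating set of size `3n + 6`.

`IsChainPrefix`, `IsChainLink` and `IsChainEnd` record these costs together with distances.
`IsChainPrefix.glue_link` is the induction step, and `IsChainPrefix.glue_end_le_card` and
`IsChainPrefix.glue_end_exists_delete` close the chain. It remains to check the three gadgets: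
`graphR_isChainPrefix`, `graphQ_isChainLink`, `graphJ_isChainEnd`.

For the diameter, each gadget is layered from Left to Right. Layer numbers change by at most one
along an edge and add up under gluing, giving the lower bound `3 + 5n + 4`; walks through the cut
vertices give the upper bound. -/

/-! ### Domination and distance, relative to a vertex set -/

/-- The vertex `x` is adjacent to a vertex of `S`. -/
def IsTotallyDominated {V : Type*} (G : SimpleGraph V) (S : Finset V) (x : V) : Prop :=
  ∃ s ∈ S, G.Adj x s

/-- There is a walk of length at most `d` from `x` to `y`. -/
def WalkWithin {V : Type*} (G : SimpleGraph V) (d : ℕ) (x y : V) : Prop :=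
  ∃ p : G.Walk x y, p.length ≤ d

namespace WalkWithin

variable {V V' : Type*} {G : SimpleGraph V} {G' : SimpleGraph V'} {d e : ℕ} {x y z : V}

lemma refl (G : SimpleGraph V) (d : ℕ) (x : V) : WalkWithin G d x x :=
  ⟨.nil, by simp⟩

lemma symm (h : WalkWithin G d x y) : WalkWithin G d y x :=
  let ⟨p, hp⟩ := h
  ⟨p.reverse, by simpa using hp⟩

lemma trans (h : WalkWithin G d x y) (h' : WalkWithin G e y z) : WalkWithin G (d + e) x z :=
  let ⟨p, hp⟩ := h
  let ⟨q, hq⟩ := h'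
  ⟨p.append q, by simp; lia⟩

lemma cons (h' : G.Adj x y) (h : WalkWithin G d y z) : WalkWithin G (d + 1) x z :=
  let ⟨p, hp⟩ := h
  ⟨.cons h' p, by simpa using hp⟩

lemma snoc (h : WalkWithin G d x y) (h' : G.Adj y z) : WalkWithin G (d + 1) x z :=
  (h.symm.cons h'.symm).symm

lemma mono (h : WalkWithin G d x y) (hde : d ≤ e) : WalkWithin G e x y :=
  let ⟨p, hp⟩ := h
  ⟨p, hp.trans hde⟩

lemma map (f : G →g G') (h : WalkWithin G d x y) : WalkWithin G' d (f x) (f y) :=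
  let ⟨p, hp⟩ := h
  ⟨p.map f, by simpa using hp⟩

end WalkWithin

/-- Each edge raises the level by at most one. This bounds the distance from Left to Right from
below. -/
lemma level_le_add_length {V : Type*} {G : SimpleGraph V} {ℓ : V → ℕ}
    (hℓ : ∀ x y, G.Adj x y → ℓ y ≤ ℓ x + 1) {x y : V} (p : G.Walk x y) :
    ℓ y ≤ ℓ x + p.length := by
  induction p with
  | nil => simp
  | cons h p ih =>
    have := hℓ _ _ h
    simp only [SimpleGraph.Walk.length_cons]
    lia

/-! ### Gluing -/

namespace PointedGraph

variable {P : PointedGraph.{u}} {Q : PointedGraph.{v}}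

open Classical in
/-- The inclusion of the second factor of `P • Q`. -/
noncomputable def glueInr (P : PointedGraph.{u}) (Q : PointedGraph.{v}) (q : Q.V) :
    (glue P Q).V :=
  if h : q = Q.left then .inl P.right else .inr ⟨q, h⟩

/-- The inclusion of the first factor of `P • Q`. -/
def glueInl (P : PointedGraph.{u}) (Q : PointedGraph.{v}) (a : P.V) : (glue P Q).V :=
  .inl a

lemma glueInr_left : glueInr P Q Q.left = glueInl P Q P.right :=
  dif_pos rfl

lemma glueInr_of_ne {q : Q.V} (h : q ≠ Q.left) : glueInr P Q q = .inr ⟨q, h⟩ :=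
  dif_neg h

lemma glue_left : (glue P Q).left = glueInl P Q P.left := rfl

lemma glue_right : (glue P Q).right = glueInr P Q Q.right := rfl

lemma glueInl_injective : Function.Injective (glueInl P Q) := Sum.inl_injective

lemma glueInr_eq_glueInl {q : Q.V} {a : P.V} :
    glueInr P Q q = glueInl P Q a ↔ q = Q.left ∧ a = P.right := by
  by_cases hq : q = Q.left
  · rw [hq, glueInr_left, glueInl_injective.eq_iff]
    simp [eq_comm]
  · rw [glueInr_of_ne hq]
    exact ⟨fun h => absurd h Sum.inr_ne_inl, fun h => absurd h.1 hq⟩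

lemma glueInr_injective : Function.Injective (glueInr P Q) := by
  intro a b h
  by_cases hb : b = Q.left
  · rw [hb, glueInr_left, glueInr_eq_glueInl] at h
    rw [h.1, hb]
  · by_cases ha : a = Q.left
    · rw [ha, glueInr_left, eq_comm, glueInr_eq_glueInl] at h
      exact absurd h.1 hb
    · rw [glueInr_of_ne ha, glueInr_of_ne hb] at h
      exact congrArg Subtype.val (Sum.inr_injective h)

lemma glue_cases (w : (glue P Q).V) :
    (∃ a, w = glueInl P Q a) ∨ ∃ q, q ≠ Q.left ∧ w = glueInr P Q q := by
  rcases w with a | ⟨q, hq⟩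
  · exact .inl ⟨a, rfl⟩
  · exact .inr ⟨q, hq, (glueInr_of_ne hq).symm⟩

lemma glue_adj_inl {a b : P.V} :
    (glue P Q).graph.Adj (glueInl P Q a) (glueInl P Q b) ↔ P.graph.Adj a b := Iff.rfl

lemma glue_adj_inl_inr {a : P.V} {q : Q.V} (hq : q ≠ Q.left) :
    (glue P Q).graph.Adj (glueInl P Q a) (glueInr P Q q) ↔
      a = P.right ∧ Q.graph.Adj Q.left q := by
  rw [glueInr_of_ne hq]; rfl

lemma glue_adj_inr {q r : Q.V} :
    (glue P Q).graph.Adj (glueInr P Q q) (glueInr P Q r) ↔ Q.graph.Adj q r := by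
  by_cases hq : q = Q.left
  · by_cases hr : r = Q.left
    · simp [hq, hr]
    · rw [hq, glueInr_left, glue_adj_inl_inr hr]; simp
  · by_cases hr : r = Q.left
    · rw [hr, glueInr_left, SimpleGraph.adj_comm, glue_adj_inl_inr hq, SimpleGraph.adj_comm]; simp
    · rw [glueInr_of_ne hq, glueInr_of_ne hr]; rfl

/-- The inclusion of the first factor as a graph homomorphism. -/
def glueInlHom (P : PointedGraph.{u}) (Q : PointedGraph.{v}) :
    P.graph →g (glue P Q).graph where
  toFun := glueInl P Q
  map_rel' h := glue_adj_inl.2 h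

/-- The inclusion of the second factor as a graph homomorphism. -/
noncomputable def glueInrHom (P : PointedGraph.{u}) (Q : PointedGraph.{v}) :
    Q.graph →g (glue P Q).graph where
  toFun := glueInr P Q
  map_rel' h := glue_adj_inr.2 h

lemma WalkWithin.glueInl {d : ℕ} {a b : P.V} (Q : PointedGraph.{v})
    (h : WalkWithin P.graph d a b) :
    WalkWithin (glue P Q).graph d (glueInl P Q a) (glueInl P Q b) :=
  h.map (glueInlHom P Q)

lemma WalkWithin.glueInr {d : ℕ} {a b : Q.V} (P : PointedGraph.{u})
    (h : WalkWithin Q.graph d a b) :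
    WalkWithin (glue P Q).graph d (glueInr P Q a) (glueInr P Q b) :=
  h.map (glueInrHom P Q)

lemma WalkWithin.glue {d e : ℕ} {a : P.V} {q : Q.V}
    (h : WalkWithin P.graph d a P.right) (h' : WalkWithin Q.graph e Q.left q) :
    WalkWithin (glue P Q).graph (d + e) (PointedGraph.glueInl P Q a)
      (PointedGraph.glueInr P Q q) := by
  have h₁ := WalkWithin.glueInl Q h
  rw [← glueInr_left] at h₁
  exact h₁.trans (WalkWithin.glueInr P h')

/-- The common vertex is a cut vertex: any other vertex keeps exactly the neighbours it has in its
own factor. -/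
lemma glue_adj_inl_left_of_ne {a : P.V} (ha : a ≠ P.right) {w : (glue P Q).V}
    (h : (glue P Q).graph.Adj (glueInl P Q a) w) : ∃ b, w = glueInl P Q b ∧ P.graph.Adj a b := by
  rcases glue_cases w with ⟨b, rfl⟩ | ⟨q, hq, rfl⟩
  · exact ⟨b, rfl, glue_adj_inl.1 h⟩
  · exact absurd ((glue_adj_inl_inr hq).1 h).1 ha

lemma glue_adj_inr_left_of_ne {q : Q.V} (hq : q ≠ Q.left) {w : (glue P Q).V}
    (h : (glue P Q).graph.Adj (glueInr P Q q) w) : ∃ r, w = glueInr P Q r ∧ Q.graph.Adj q r := by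
  rcases glue_cases w with ⟨b, rfl⟩ | ⟨r, hr, rfl⟩
  · obtain ⟨rfl, h'⟩ := (glue_adj_inl_inr hq).1 h.symm
    exact ⟨Q.left, glueInr_left.symm, h'.symm⟩
  · exact ⟨r, rfl, glue_adj_inr.1 h⟩

open Classical in
/-- Restricting a set of vertices of `P • Q` to both factors. -/
lemma glue_exists_split (S : Finset (glue P Q).V) :
    ∃ (S₁ : Finset P.V) (S₂ : Finset Q.V), (∀ a, a ∈ S₁ ↔ glueInl P Q a ∈ S) ∧
      (∀ q, q ∈ S₂ ↔ glueInr P Q q ∈ S) ∧ S.card = S₁.card + (S₂.erase Q.left).card := by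
  refine ⟨S.preimage _ glueInl_injective.injOn, S.preimage _ glueInr_injective.injOn,
    by simp, by simp, ?_⟩
  -- The common vertex is counted on the side of `P`, hence the erasure of Left on the side of `Q`.
  rw [← Finset.card_image_of_injective _ (glueInl_injective (P := P) (Q := Q)),
    ← Finset.card_image_of_injective _ (glueInr_injective (P := P) (Q := Q)),
    ← Finset.card_union_of_disjoint]
  · congr 1
    ext w
    simp only [Finset.mem_union, Finset.mem_image, Finset.mem_preimage, Finset.mem_erase]
    constructor
    · intro hw
      rcases glue_cases w with ⟨b, rfl⟩ | ⟨r, hr, rfl⟩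
      · exact .inl ⟨b, hw, rfl⟩
      · exact .inr ⟨r, ⟨hr, hw⟩, rfl⟩
    · rintro (⟨b, hb, rfl⟩ | ⟨r, ⟨-, hr⟩, rfl⟩) <;> assumption
  · simp only [Finset.disjoint_left, Finset.mem_image, Finset.mem_preimage, Finset.mem_erase]
    rintro _ ⟨a, -, rfl⟩ ⟨q, ⟨hq, -⟩, h⟩
    exact hq (glueInr_eq_glueInl.1 h).1

open Classical in
/-- The union of sets of vertices of both factors of `P • Q`. -/
noncomputable def glueUnion (S₁ : Finset P.V) (S₂ : Finset Q.V) : Finset (glue P Q).V :=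
  S₁.image (glueInl P Q) ∪ S₂.image (glueInr P Q)

section glueUnion

variable {S₁ : Finset P.V} {S₂ : Finset Q.V}

lemma glueInl_mem_glueUnion {a : P.V} :
    glueInl P Q a ∈ glueUnion S₁ S₂ ↔ a ∈ S₁ ∨ a = P.right ∧ Q.left ∈ S₂ := by
  classical
  simp only [glueUnion, Finset.mem_union, Finset.mem_image, glueInl_injective.eq_iff,
    glueInr_eq_glueInl]
  aesop

lemma glueInr_mem_glueUnion {q : Q.V} :
    glueInr P Q q ∈ glueUnion S₁ S₂ ↔ q ∈ S₂ ∨ q = Q.left ∧ P.right ∈ S₁ := by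
  classical
  simp only [glueUnion, Finset.mem_union, Finset.mem_image, glueInr_injective.eq_iff,
    eq_comm (a := glueInl P Q _), glueInr_eq_glueInl]
  aesop

lemma card_glueUnion_le : (glueUnion S₁ S₂).card ≤ S₁.card + S₂.card := by
  classical
  exact (Finset.card_union_le _ _).trans (add_le_add Finset.card_image_le Finset.card_image_le)

/-- The common vertex is counted twice on the right. This saved unit is what makes the sizes add up
when both parts contain it. -/
lemma card_glueUnion_lt (h₁ : P.right ∈ S₁) (h₂ : Q.left ∈ S₂) :
    (glueUnion S₁ S₂).card < S₁.card + S₂.card := by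
  classical
  have h := Finset.card_union_add_card_inter (S₁.image (glueInl P Q)) (S₂.image (glueInr P Q))
  have hpos : 0 < (S₁.image (glueInl P Q) ∩ S₂.image (glueInr P Q)).card :=
    Finset.card_pos.2 ⟨glueInl P Q P.right, Finset.mem_inter.2
      ⟨Finset.mem_image_of_mem _ h₁, glueInr_left (P := P) ▸ Finset.mem_image_of_mem _ h₂⟩⟩
  have e₁ := Finset.card_image_of_injective S₁ (glueInl_injective (P := P) (Q := Q))
  have e₂ := Finset.card_image_of_injective S₂ (glueInr_injective (P := P) (Q := Q))
  unfold glueUnion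
  lia

lemma isTotallyDominated_glueUnion_inl {a : P.V} (h : IsTotallyDominated P.graph S₁ a) :
    IsTotallyDominated (glue P Q).graph (glueUnion S₁ S₂) (glueInl P Q a) :=
  let ⟨_, hs, has⟩ := h
  ⟨_, glueInl_mem_glueUnion.2 (.inl hs), glue_adj_inl.2 has⟩

lemma isTotallyDominated_glueUnion_inr {q : Q.V} (h : IsTotallyDominated Q.graph S₂ q) :
    IsTotallyDominated (glue P Q).graph (glueUnion S₁ S₂) (glueInr P Q q) :=
  let ⟨_, hs, has⟩ := h
  ⟨_, glueInr_mem_glueUnion.2 (.inl hs), glue_adj_inr.2 has⟩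

end glueUnion

lemma isTotallyDominated_of_glue_inl {S : Finset (glue P Q).V} {S₁ : Finset P.V}
    (h₁ : ∀ a, a ∈ S₁ ↔ glueInl P Q a ∈ S) {a : P.V} (ha : a ≠ P.right)
    (h : IsTotallyDominated (glue P Q).graph S (glueInl P Q a)) :
    IsTotallyDominated P.graph S₁ a := by
  obtain ⟨s, hs, h⟩ := h
  obtain ⟨b, rfl, hb⟩ := glue_adj_inl_left_of_ne ha h
  exact ⟨b, (h₁ b).2 hs, hb⟩

lemma isTotallyDominated_of_glue_inr {S : Finset (glue P Q).V} {S₂ : Finset Q.V}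
    (h₂ : ∀ q, q ∈ S₂ ↔ glueInr P Q q ∈ S) {q : Q.V} (hq : q ≠ Q.left)
    (h : IsTotallyDominated (glue P Q).graph S (glueInr P Q q)) :
    IsTotallyDominated Q.graph S₂ q := by
  obtain ⟨s, hs, h⟩ := h
  obtain ⟨b, rfl, hb⟩ := glue_adj_inr_left_of_ne hq h
  exact ⟨b, (h₂ b).2 hs, hb⟩

lemma isTotallyDominated_of_glue_right {S : Finset (glue P Q).V} {S₁ : Finset P.V}
    {S₂ : Finset Q.V} (h₁ : ∀ a, a ∈ S₁ ↔ glueInl P Q a ∈ S)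
    (h₂ : ∀ q, q ∈ S₂ ↔ glueInr P Q q ∈ S)
    (h : IsTotallyDominated (glue P Q).graph S (glueInl P Q P.right)) :
    IsTotallyDominated P.graph S₁ P.right ∨ IsTotallyDominated Q.graph S₂ Q.left := by
  obtain ⟨s, hs, h⟩ := h
  rcases glue_cases s with ⟨b, rfl⟩ | ⟨r, hr, rfl⟩
  · exact .inl ⟨b, (h₁ b).2 hs, glue_adj_inl.1 h⟩
  · exact .inr ⟨r, (h₂ r).2 hs, ((glue_adj_inl_inr hr).1 h).2⟩

/-- The levels of the second factor are shifted by `d`; the two functions then agree at the common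
vertex. -/
lemma glue_exists_level {d e : ℕ}
    (hP : ∃ ℓ : P.V → ℕ, ℓ P.left = 0 ∧ ℓ P.right = d ∧ ∀ x y, P.graph.Adj x y → ℓ y ≤ ℓ x + 1)
    (hQ : ∃ ℓ : Q.V → ℕ, ℓ Q.left = 0 ∧ ℓ Q.right = e ∧ ∀ x y, Q.graph.Adj x y → ℓ y ≤ ℓ x + 1) :
    ∃ ℓ : (glue P Q).V → ℕ, ℓ (glue P Q).left = 0 ∧ ℓ (glue P Q).right = d + e ∧
      ∀ x y, (glue P Q).graph.Adj x y → ℓ y ≤ ℓ x + 1 := by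
  obtain ⟨f, f₁, f₂, f₃⟩ := hP
  obtain ⟨g, g₁, g₂, g₃⟩ := hQ
  let ℓ : (glue P Q).V → ℕ := Sum.elim f fun q => d + g q
  have hl : ∀ a, ℓ (glueInl P Q a) = f a := fun _ => rfl
  have hr : ∀ q, ℓ (glueInr P Q q) = d + g q := by
    intro q
    by_cases hq : q = Q.left
    · rw [hq, glueInr_left, hl, f₂, g₁, add_zero]
    · rw [glueInr_of_ne hq]; rfl
  refine ⟨ℓ, by rw [glue_left, hl, f₁], by rw [glue_right, hr, g₂], ?_⟩
  intro x y hxy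
  rcases glue_cases x with ⟨a, rfl⟩ | ⟨q, hq, rfl⟩
  · rcases glue_cases y with ⟨b, rfl⟩ | ⟨r, hr', rfl⟩
    · rw [hl, hl]; exact f₃ _ _ (glue_adj_inl.1 hxy)
    · obtain ⟨rfl, h⟩ := (glue_adj_inl_inr hr').1 hxy
      have := g₃ _ _ h
      rw [hl, hr]; lia
  · obtain ⟨r, rfl, h⟩ := glue_adj_inr_left_of_ne hq hxy
    have := g₃ _ _ h
    rw [hr, hr]; lia

/-! ### Associativity of gluing and the neutral element -/

/-- Gluing is associative. -/
noncomputable def glueAssoc (A B C : PointedGraph) (hB : B.right ≠ B.left) :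
    (glue (glue A B) C).graph ≃g (glue A (glue B C)).graph where
  toFun
    | .inl (.inl a) => .inl a
    | .inl (.inr b) => .inr ⟨.inl b.1, fun h => b.2 (Sum.inl_injective h)⟩
    | .inr c => .inr ⟨.inr c, Sum.inr_ne_inl⟩
  invFun
    | .inl a => .inl (.inl a)
    | .inr ⟨.inl b, h⟩ => .inl (.inr ⟨b, fun hb => h (congrArg _ hb)⟩)
    | .inr ⟨.inr c, _⟩ => .inr c
  left_inv := by rintro ((a | b) | c) <;> rfl
  right_inv := by rintro (a | ⟨b | c, h⟩) <;> rfl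
  map_rel_iff' := by
    have hr : (glue A B).right = .inr ⟨B.right, hB⟩ := glueInr_of_ne hB
    have hr_inl (a : A.V) : (Sum.inl a : (glue A B).V) ≠ (glue A B).right := by
      rw [hr]; exact Sum.inl_ne_inr
    have hr_inr (b : {w : B.V // w ≠ B.left}) :
        (Sum.inr b : (glue A B).V) = (glue A B).right ↔ b.1 = B.right := by
      rw [hr]
      exact ⟨fun h => congrArg Subtype.val (Sum.inr_injective h),
        fun h => congrArg Sum.inr (Subtype.ext h)⟩
    rintro ((a | b) | c) ((a' | b') | c')
    · exact Iff.rfl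
    · exact Iff.rfl
    · exact ⟨fun h => absurd h.2.1.symm hB, fun h => absurd h.1 (hr_inl a)⟩
    · exact Iff.rfl
    · exact Iff.rfl
    · exact and_congr_left' (hr_inr b).symm
    · exact ⟨fun h => absurd h.2.1.symm hB, fun h => absurd h.1 (hr_inl a')⟩
    · exact and_congr_left' (hr_inr b').symm
    · exact Iff.rfl

lemma glueAssoc_left (A B C : PointedGraph) (hB : B.right ≠ B.left) :
    glueAssoc A B C hB (glue (glue A B) C).left = (glue A (glue B C)).left := rfl

lemma glueAssoc_right (A B C : PointedGraph) (hB : B.right ≠ B.left) (hC : C.right ≠ C.left) :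
    glueAssoc A B C hB (glue (glue A B) C).right = (glue A (glue B C)).right := by
  have h : glueInr B C C.right ≠ glueInl B C B.left := by
    rw [glueInr_of_ne hC]; exact Sum.inr_ne_inl
  have e : (glue A (glue B C)).right = .inr ⟨glueInr B C C.right, h⟩ := glueInr_of_ne h
  simp only [glue_right (P := glue A B), e, glueInr_of_ne hC]
  rfl

/-- The single vertex is neutral for gluing on the right. -/
def gluePoint (A : PointedGraph.{u}) : A.graph ≃g (glue A point.{v}).graph where
  toFun := glueInl A point
  invFun
    | .inl a => a
    | .inr b => (b.2 rfl).elim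
  left_inv _ := rfl
  right_inv := by
    rintro (a | b)
    · rfl
    · exact (b.2 rfl).elim
  map_rel_iff' := Iff.rfl

lemma gluePoint_right (A : PointedGraph.{u}) :
    gluePoint A A.right = (glue A point.{v}).right :=
  (glueInr_left (P := A) (Q := point)).symm

end PointedGraph

/-! ### Chains of pointed graphs -/

namespace PointedGraph

/-- The properties of `R • Q^(k)` used to extend it on the right: the sizes of sets that dominate
all of its vertices other than Right (and possibly one deleted vertex), and distances. -/
structure IsChainPrefix (P : PointedGraph.{u}) (k : ℕ) : Prop where
  le_card : ∀ S : Finset P.V, (∀ x, x ≠ P.right → IsTotallyDominated P.graph S x) →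
    3 * k + 2 ≤ S.card ∧
      (P.right ∈ S ∨ IsTotallyDominated P.graph S P.right → 3 * k + 3 ≤ S.card)
  exists_mem : ∃ S : Finset P.V, S.card ≤ 3 * k + 3 ∧ P.right ∈ S ∧
    ∀ x, IsTotallyDominated P.graph S x
  exists_notMem : ∃ S : Finset P.V, S.card ≤ 3 * k + 2 ∧ P.right ∉ S ∧
    ∀ x, x ≠ P.right → IsTotallyDominated P.graph S x
  -- Right may be contained without being dominated; the next piece then has to dominate it, but
  -- gets it for free.
  exists_delete : ∀ w, w ≠ P.right → ∃ S : Finset P.V, S.card ≤ 3 * k + 2 ∧ w ∉ S ∧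
    (P.right ∈ S ∨ IsTotallyDominated P.graph S P.right) ∧
    ∀ x, x ≠ w → x ≠ P.right → IsTotallyDominated P.graph S x
  walk_right : ∀ x, WalkWithin P.graph (5 * k + 3) x P.right
  walk : ∀ x y, WalkWithin P.graph (5 * k + 7) x y
  exists_level : ∃ ℓ : P.V → ℕ, ℓ P.left = 0 ∧ ℓ P.right = 5 * k + 3 ∧
    ∀ x y, P.graph.Adj x y → ℓ y ≤ ℓ x + 1

open Classical in
/-- The properties of `Q` used to extend a chain by `Q`. -/
structure IsChainLink (Q : PointedGraph.{u}) : Prop where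
  right_ne_left : Q.right ≠ Q.left
  -- Left is erased from the count because the prefix already pays for the common vertex.
  le_card : ∀ S : Finset Q.V,
    (∀ x, x ≠ Q.left → x ≠ Q.right → IsTotallyDominated Q.graph S x) →
    2 ≤ (S.erase Q.left).card ∧
      (Q.right ∈ S ∨ IsTotallyDominated Q.graph S Q.right → 3 ≤ (S.erase Q.left).card)
  le_card_of_left : ∀ S : Finset Q.V,
    (∀ x, x ≠ Q.right → IsTotallyDominated Q.graph S x) → Q.left ∉ S →
    3 ≤ (S.erase Q.left).card ∧
      (Q.right ∈ S ∨ IsTotallyDominated Q.graph S Q.right → 4 ≤ (S.erase Q.left).card)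
  exists_mem_mem : ∃ S : Finset Q.V, S.card ≤ 4 ∧ Q.left ∈ S ∧ Q.right ∈ S ∧
    ∀ x, x ≠ Q.left → IsTotallyDominated Q.graph S x
  exists_mem_notMem : ∃ S : Finset Q.V, S.card ≤ 3 ∧ Q.left ∈ S ∧ Q.right ∉ S ∧
    ∀ x, x ≠ Q.left → x ≠ Q.right → IsTotallyDominated Q.graph S x
  exists_mem_mem' : ∃ S : Finset Q.V, S.card ≤ 4 ∧ Q.left ∈ S ∧ Q.right ∈ S ∧
    ∀ x, x ≠ Q.right → IsTotallyDominated Q.graph S x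
  exists_notMem_mem : ∃ S : Finset Q.V, S.card ≤ 3 ∧ Q.left ∉ S ∧ Q.right ∈ S ∧
    ∀ x, x ≠ Q.left → x ≠ Q.right → IsTotallyDominated Q.graph S x
  -- The first alternative dominates Left itself and combines with `IsChainPrefix.exists_notMem`;
  -- the second relies on Left and combines with `IsChainPrefix.exists_mem`.
  exists_delete : ∀ w, w ≠ Q.left → w ≠ Q.right →
    (∃ S : Finset Q.V, S.card ≤ 3 ∧ w ∉ S ∧ Q.left ∉ S ∧ Q.right ∈ S ∧
      ∀ x, x ≠ w → x ≠ Q.right → IsTotallyDominated Q.graph S x) ∨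
    (∃ S : Finset Q.V, S.card ≤ 3 ∧ w ∉ S ∧ Q.left ∈ S ∧
      ∀ x, x ≠ w → x ≠ Q.left → IsTotallyDominated Q.graph S x)
  walk_left : ∀ x, WalkWithin Q.graph 5 Q.left x
  walk_right : ∀ x, WalkWithin Q.graph 5 x Q.right
  exists_level : ∃ ℓ : Q.V → ℕ, ℓ Q.left = 0 ∧ ℓ Q.right = 5 ∧
    ∀ x y, Q.graph.Adj x y → ℓ y ≤ ℓ x + 1

open Classical in
/-- The properties of `J` used to close a chain. -/
structure IsChainEnd (J : PointedGraph.{u}) : Prop where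
  le_card : ∀ S : Finset J.V, (∀ x, x ≠ J.left → IsTotallyDominated J.graph S x) →
    3 ≤ (S.erase J.left).card ∧
      (J.left ∉ S → IsTotallyDominated J.graph S J.left → 4 ≤ (S.erase J.left).card)
  exists_mem : ∃ S : Finset J.V, S.card ≤ 4 ∧ J.left ∈ S ∧ ∀ x, IsTotallyDominated J.graph S x
  exists_notMem : ∃ S : Finset J.V, S.card ≤ 3 ∧ J.left ∉ S ∧
    ∀ x, x ≠ J.left → IsTotallyDominated J.graph S x
  exists_delete : ∀ w, w ≠ J.left →
    (∃ S : Finset J.V, S.card ≤ 3 ∧ w ∉ S ∧ J.left ∈ S ∧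
      ∀ x, x ≠ w → x ≠ J.left → IsTotallyDominated J.graph S x) ∨
    (∃ S : Finset J.V, S.card ≤ 3 ∧ w ∉ S ∧ J.left ∉ S ∧
      ∀ x, x ≠ w → IsTotallyDominated J.graph S x)
  walk_left : ∀ x, WalkWithin J.graph 4 J.left x
  -- Two vertices of the end other than a pair of copies of Right are then at distance at most `4 +
  -- 3 = 7`, which is the diameter claimed for `n = 0`.
  walk_left_of_ne : ∀ x, x ≠ J.right → WalkWithin J.graph 3 J.left x
  exists_level : ∃ ℓ : J.V → ℕ, ℓ J.left = 0 ∧ ℓ J.right = 4 ∧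
    ∀ x y, J.graph.Adj x y → ℓ y ≤ ℓ x + 1

/-! ### Transport along isomorphisms -/

lemma isTotallyDominated_map {V V' : Type*} {G : SimpleGraph V} {G' : SimpleGraph V'}
    (e : G ≃g G') {S : Finset V} {x : V} :
    IsTotallyDominated G' (S.map e.toEquiv.toEmbedding) (e x) ↔ IsTotallyDominated G S x := by
  constructor
  · rintro ⟨s, hs, h⟩
    obtain ⟨t, ht, rfl⟩ := Finset.mem_map.1 hs
    exact ⟨t, ht, e.map_adj_iff.1 h⟩
  · rintro ⟨s, hs, h⟩
    exact ⟨e s, Finset.mem_map.2 ⟨s, hs, rfl⟩, e.map_adj_iff.2 h⟩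

lemma IsChainPrefix.of_iso {P : PointedGraph.{u}} {P' : PointedGraph.{v}} {k : ℕ}
    (h : IsChainPrefix P k) (e : P.graph ≃g P'.graph) (hl : e P.left = P'.left)
    (hr : e P.right = P'.right) : IsChainPrefix P' k := by
  have ne_right {x : P.V} : e x ≠ P'.right ↔ x ≠ P.right := by
    rw [← hr]; exact e.injective.ne_iff
  have mem {S : Finset P.V} {x : P.V} : e x ∈ S.map e.toEquiv.toEmbedding ↔ x ∈ S :=
    Finset.mem_map' e.toEquiv.toEmbedding
  refine ⟨?_, ?_, ?_, ?_, ?_, ?_, ?_⟩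
  · intro S hS
    obtain ⟨S, rfl⟩ : ∃ T : Finset P.V, S = T.map e.toEquiv.toEmbedding :=
      ⟨S.map e.symm.toEquiv.toEmbedding, by simp [Finset.map_map]⟩
    have := h.le_card S fun x hx => (isTotallyDominated_map e).1 (hS _ (ne_right.2 hx))
    rwa [← hr, mem, isTotallyDominated_map, Finset.card_map]
  · obtain ⟨S, h₁, h₂, h₃⟩ := h.exists_mem
    refine ⟨S.map e.toEquiv.toEmbedding, by simpa using h₁, hr ▸ mem.2 h₂, e.surjective.forall.2 ?_⟩
    exact fun x => (isTotallyDominated_map e).2 (h₃ x)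
  · obtain ⟨S, h₁, h₂, h₃⟩ := h.exists_notMem
    refine ⟨S.map e.toEquiv.toEmbedding, by simpa using h₁, hr ▸ mem.not.2 h₂,
      e.surjective.forall.2 ?_⟩
    exact fun x hx => (isTotallyDominated_map e).2 (h₃ x (ne_right.1 hx))
  · refine e.surjective.forall.2 fun w hw => ?_
    obtain ⟨S, h₁, h₂, h₃, h₄⟩ := h.exists_delete w (ne_right.1 hw)
    refine ⟨S.map e.toEquiv.toEmbedding, by simpa using h₁, mem.not.2 h₂, ?_,
      e.surjective.forall.2 ?_⟩
    · rwa [← hr, mem, isTotallyDominated_map]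
    · exact fun x hxw hx =>
        (isTotallyDominated_map e).2 (h₄ x (e.injective.ne_iff.1 hxw) (ne_right.1 hx))
  · exact e.surjective.forall.2 fun x => hr ▸ (h.walk_right x).map e.toHom
  · exact e.surjective.forall.2 fun x => e.surjective.forall.2 fun y => (h.walk x y).map e.toHom
  · obtain ⟨ℓ, h₁, h₂, h₃⟩ := h.exists_level
    refine ⟨ℓ ∘ e.symm, by simp [← hl, h₁], by simp [← hr, h₂], fun x y hxy => h₃ _ _ ?_⟩
    exact (e.symm.map_adj_iff).2 hxy

/-! ### Extending a chain by a link and closing it with an end -/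

section Glue

variable {P : PointedGraph.{u}} {Q : PointedGraph.{v}} {k : ℕ}

/-- A union of sets dominates a vertex set of `P • Q` if both parts do, where the common vertex
is to be dominated by one of them. -/
lemma forall_isTotallyDominated_glueUnion {S₁ : Finset P.V} {S₂ : Finset Q.V}
    {p : (glue P Q).V → Prop}
    (h₁ : ∀ a, a ≠ P.right → p (glueInl P Q a) → IsTotallyDominated P.graph S₁ a)
    (h₂ : ∀ q, q ≠ Q.left → p (glueInr P Q q) → IsTotallyDominated Q.graph S₂ q)
    (h : p (glueInl P Q P.right) →
      IsTotallyDominated P.graph S₁ P.right ∨ IsTotallyDominated Q.graph S₂ Q.left)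
    (w : (glue P Q).V) (hw : p w) :
    IsTotallyDominated (glue P Q).graph (glueUnion S₁ S₂) w := by
  rcases glue_cases w with ⟨a, rfl⟩ | ⟨q, hq, rfl⟩
  · by_cases ha : a = P.right
    · subst ha
      rcases h hw with h | h
      · exact isTotallyDominated_glueUnion_inl h
      · rw [← glueInr_left]
        exact isTotallyDominated_glueUnion_inr h
    · exact isTotallyDominated_glueUnion_inl (h₁ a ha hw)
  · exact isTotallyDominated_glueUnion_inr (h₂ q hq hw)

lemma glueInl_ne_right (hQ : Q.right ≠ Q.left) (a : P.V) :
    glueInl P Q a ≠ (glue P Q).right := by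
  rw [glue_right, ne_comm, Ne, glueInr_eq_glueInl]
  exact fun h => hQ h.1

lemma glueInr_ne_right {q : Q.V} : glueInr P Q q ≠ (glue P Q).right ↔ q ≠ Q.right := by
  rw [glue_right]
  exact glueInr_injective.ne_iff

lemma IsChainPrefix.glue_link_le_card (hP : P.IsChainPrefix k) (hQ : Q.IsChainLink)
    (S : Finset (glue P Q).V)
    (hS : ∀ x, x ≠ (glue P Q).right → IsTotallyDominated (glue P Q).graph S x) :
    3 * (k + 1) + 2 ≤ S.card ∧ ((glue P Q).right ∈ S ∨
      IsTotallyDominated (glue P Q).graph S (glue P Q).right → 3 * (k + 1) + 3 ≤ S.card) := by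
  classical
  obtain ⟨S₁, S₂, h₁, h₂, hc⟩ := glue_exists_split S
  have hP' := hP.le_card S₁ fun a ha =>
    isTotallyDominated_of_glue_inl h₁ ha (hS _ (glueInl_ne_right hQ.right_ne_left a))
  have hd : ∀ q, q ≠ Q.left → q ≠ Q.right → IsTotallyDominated Q.graph S₂ q := fun q hq hq' =>
    isTotallyDominated_of_glue_inr h₂ hq (hS _ (glueInr_ne_right.2 hq'))
  have hQ' := hQ.le_card S₂ hd
  have hmid := isTotallyDominated_of_glue_right h₁ h₂
    (hS _ (glueInl_ne_right hQ.right_ne_left P.right))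
  have hlr : Q.left ∈ S₂ ↔ P.right ∈ S₁ := by rw [h₁, h₂, glueInr_left]
  have himp : (glue P Q).right ∈ S ∨ IsTotallyDominated (glue P Q).graph S (glue P Q).right →
      Q.right ∈ S₂ ∨ IsTotallyDominated Q.graph S₂ Q.right := by
    rintro (h | h)
    · exact .inl ((h₂ _).2 h)
    · exact .inr (isTotallyDominated_of_glue_inr h₂ hQ.right_ne_left h)
  -- If the prefix part contains or dominates the common vertex, it costs `3k + 3` and the link at
  -- least 2. Otherwise the link must dominate that vertex without containing it: the costs are `3k
  -- + 2` and 3. Both sums are `3(k + 1) + 2`, and serving Right costs one more.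
  by_cases hin : P.right ∈ S₁ ∨ IsTotallyDominated P.graph S₁ P.right
  · have := hP'.2 hin
    exact ⟨by lia, fun h => by have := hQ'.2 (himp h); lia⟩
  · push Not at hin
    have hleft := hmid.resolve_left hin.2
    have hQ'' := hQ.le_card_of_left S₂ (fun q hq => by
      by_cases hq' : q = Q.left
      · rwa [hq']
      · exact hd q hq' hq) (by rw [hlr]; exact hin.1)
    exact ⟨by lia, fun h => by have := hQ''.2 (himp h); lia⟩

lemma IsChainPrefix.glue_link (hP : P.IsChainPrefix k) (hQ : Q.IsChainLink) :
    (glue P Q).IsChainPrefix (k + 1) := by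
  have right_mem {S₁ : Finset P.V} {S₂ : Finset Q.V} :
      (glue P Q).right ∈ glueUnion S₁ S₂ ↔ Q.right ∈ S₂ := by
    rw [glue_right, glueInr_mem_glueUnion]
    simp [hQ.right_ne_left]
  have inl_mem {S₁ : Finset P.V} {S₂ : Finset Q.V} {a : P.V} (ha : a ≠ P.right) :
      glueInl P Q a ∈ glueUnion S₁ S₂ ↔ a ∈ S₁ := by
    rw [glueInl_mem_glueUnion]
    simp [ha]
  have inr_mem {S₁ : Finset P.V} {S₂ : Finset Q.V} {q : Q.V} (hq : q ≠ Q.left) :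
      glueInr P Q q ∈ glueUnion S₁ S₂ ↔ q ∈ S₂ := by
    rw [glueInr_mem_glueUnion]
    simp [hq]
  refine ⟨hP.glue_link_le_card hQ, ?_, ?_, ?_, ?_, ?_, ?_⟩
  · obtain ⟨S₁, c₁, r₁, d₁⟩ := hP.exists_mem
    obtain ⟨S₂, c₂, l₂, r₂, d₂⟩ := hQ.exists_mem_mem
    refine ⟨glueUnion S₁ S₂, ?_, right_mem.2 r₂, fun x =>
      forall_isTotallyDominated_glueUnion (p := fun _ => True) (fun a _ _ => d₁ a)
        (fun q hq _ => d₂ q hq) (fun _ => .inl (d₁ _)) x trivial⟩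
    have := card_glueUnion_lt r₁ l₂
    lia
  · obtain ⟨S₁, c₁, r₁, d₁⟩ := hP.exists_mem
    obtain ⟨S₂, c₂, l₂, r₂, d₂⟩ := hQ.exists_mem_notMem
    refine ⟨glueUnion S₁ S₂, ?_, right_mem.not.2 r₂,
      forall_isTotallyDominated_glueUnion (p := (· ≠ (glue P Q).right)) (fun a _ _ => d₁ a)
        (fun q hq hq' => d₂ q hq (glueInr_ne_right.1 hq')) (fun _ => .inl (d₁ _))⟩
    have := card_glueUnion_lt r₁ l₂
    lia
  · intro w hw
    rcases glue_cases w with ⟨a, rfl⟩ | ⟨q, hq, rfl⟩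
    · obtain ⟨T, cT, lT, rT, dT⟩ := hQ.exists_notMem_mem
      by_cases ha : a = P.right
      · subst ha
        obtain ⟨S₁, c₁, r₁, d₁⟩ := hP.exists_notMem
        refine ⟨glueUnion S₁ T, ?_, ?_, .inl (right_mem.2 rT), fun x hx hx' =>
          forall_isTotallyDominated_glueUnion
            (p := fun x => x ≠ glueInl P Q P.right ∧ x ≠ (glue P Q).right)
            (fun a ha _ => d₁ a ha) (fun q hq hq' => dT q hq (glueInr_ne_right.1 hq'.2))
            (fun h => absurd rfl h.1) x ⟨hx, hx'⟩⟩
        · have := card_glueUnion_le (S₁ := S₁) (S₂ := T)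
          lia
        · rw [glueInl_mem_glueUnion]
          simp [r₁, lT]
      · obtain ⟨S₁, c₁, w₁, r₁, d₁⟩ := hP.exists_delete a ha
        -- A contained common vertex may still be undominated, so the link part must dominate it;
        -- that part has four vertices but shares one, giving `(3k + 2) + 4 - 1`. A dominated common
        -- vertex leaves only the interior of the link, giving `(3k + 2) + 3`.
        by_cases hr : P.right ∈ S₁
        · obtain ⟨S₂, c₂, l₂, r₂, d₂⟩ := hQ.exists_mem_mem'
          refine ⟨glueUnion S₁ S₂, ?_, (inl_mem ha).not.2 w₁, .inl (right_mem.2 r₂),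
            fun x hx hx' => forall_isTotallyDominated_glueUnion
              (p := fun x => x ≠ glueInl P Q a ∧ x ≠ (glue P Q).right)
              (fun b hb hb' => d₁ b (fun h => hb'.1 (congrArg _ h)) hb)
              (fun q hq hq' => d₂ q (glueInr_ne_right.1 hq'.2))
              (fun _ => .inr (d₂ _ hQ.right_ne_left.symm)) x ⟨hx, hx'⟩⟩
          have := card_glueUnion_lt hr l₂
          lia
        · refine ⟨glueUnion S₁ T, ?_, (inl_mem ha).not.2 w₁, .inl (right_mem.2 rT),
            fun x hx hx' => forall_isTotallyDominated_glueUnion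
              (p := fun x => x ≠ glueInl P Q a ∧ x ≠ (glue P Q).right)
              (fun b hb hb' => d₁ b (fun h => hb'.1 (congrArg _ h)) hb)
              (fun q hq hq' => dT q hq (glueInr_ne_right.1 hq'.2))
              (fun _ => .inl (r₁.resolve_left hr)) x ⟨hx, hx'⟩⟩
          have := card_glueUnion_le (S₁ := S₁) (S₂ := T)
          lia
    · have hne {r : Q.V} (h : glueInr P Q r ≠ glueInr P Q q) : r ≠ q := fun h' =>
        h (congrArg _ h')
      rcases hQ.exists_delete q hq (glueInr_ne_right.1 hw) with
        ⟨S₂, c₂, w₂, l₂, r₂, d₂⟩ | ⟨S₂, c₂, w₂, l₂, d₂⟩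
      · obtain ⟨S₁, c₁, r₁, d₁⟩ := hP.exists_notMem
        refine ⟨glueUnion S₁ S₂, ?_, (inr_mem hq).not.2 w₂, .inl (right_mem.2 r₂),
          fun x hx hx' => forall_isTotallyDominated_glueUnion
            (p := fun x => x ≠ glueInr P Q q ∧ x ≠ (glue P Q).right)
            (fun b hb _ => d₁ b hb)
            (fun r _ hr => d₂ r (hne hr.1) (glueInr_ne_right.1 hr.2))
            (fun _ => .inr (d₂ _ hq.symm hQ.right_ne_left.symm)) x ⟨hx, hx'⟩⟩
        have := card_glueUnion_le (S₁ := S₁) (S₂ := S₂)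
        lia
      · obtain ⟨S₁, c₁, r₁, d₁⟩ := hP.exists_mem
        refine ⟨glueUnion S₁ S₂, ?_, (inr_mem hq).not.2 w₂,
          .inr (isTotallyDominated_glueUnion_inr
            (d₂ _ (glueInr_ne_right.1 hw).symm hQ.right_ne_left)),
          fun x hx hx' => forall_isTotallyDominated_glueUnion
            (p := fun x => x ≠ glueInr P Q q ∧ x ≠ (glue P Q).right)
            (fun b _ _ => d₁ b)
            (fun r hr hr' => d₂ r (hne hr'.1) hr)
            (fun _ => .inl (d₁ _)) x ⟨hx, hx'⟩⟩
        have := card_glueUnion_lt r₁ l₂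
        lia
  · intro x
    rcases glue_cases x with ⟨a, rfl⟩ | ⟨q, hq, rfl⟩
    · exact (WalkWithin.glue (hP.walk_right a) (hQ.walk_left _)).mono (by lia)
    · exact (WalkWithin.glueInr P (hQ.walk_right q)).mono (by lia)
  · intro x y
    rcases glue_cases x with ⟨a, rfl⟩ | ⟨q, hq, rfl⟩ <;>
      rcases glue_cases y with ⟨b, rfl⟩ | ⟨r, hr, rfl⟩
    · exact (WalkWithin.glueInl Q (hP.walk a b)).mono (by lia)
    · exact (WalkWithin.glue (hP.walk_right a) (hQ.walk_left _)).mono (by lia)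
    · exact (WalkWithin.glue (hP.walk_right b) (hQ.walk_left _)).symm.mono (by lia)
    · exact (WalkWithin.glueInr P ((hQ.walk_left q).symm.trans (hQ.walk_left r))).mono (by lia)
  · have := glue_exists_level hP.exists_level hQ.exists_level
    rwa [show 5 * k + 3 + 5 = 5 * (k + 1) + 3 by ring] at this

variable {J : PointedGraph.{v}}

lemma IsChainPrefix.glue_end_le_card (hP : P.IsChainPrefix k) (hJ : J.IsChainEnd)
    (S : Finset (glue P J).V) (hS : IsTotalDominatingSet (glue P J).graph S) :
    3 * k + 6 ≤ S.card := by
  classical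
  obtain ⟨S₁, S₂, h₁, h₂, hc⟩ := glue_exists_split S
  have hP' := hP.le_card S₁ fun a ha => isTotallyDominated_of_glue_inl h₁ ha (hS _)
  have hJ' := hJ.le_card S₂ fun q hq => isTotallyDominated_of_glue_inr h₂ hq (hS _)
  have hmid := isTotallyDominated_of_glue_right h₁ h₂ (hS _)
  have hlr : J.left ∈ S₂ ↔ P.right ∈ S₁ := by rw [h₁, h₂, glueInr_left]
  -- The same exchange as for a link: `(3k + 3) + 3` in one case, `(3k + 2) + 4` in the other.
  by_cases hin : P.right ∈ S₁ ∨ IsTotallyDominated P.graph S₁ P.right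
  · have := hP'.2 hin
    lia
  · push Not at hin
    have := hJ'.2 (by rw [hlr]; exact hin.1) (hmid.resolve_left hin.2)
    lia

lemma IsChainPrefix.glue_end_exists_delete (hP : P.IsChainPrefix k) (hJ : J.IsChainEnd)
    (w : (glue P J).V) : ∃ S : Finset (glue P J).V, S.card ≤ 3 * k + 5 ∧ w ∉ S ∧
      ∀ x, x ≠ w → IsTotallyDominated (glue P J).graph S x := by
  rcases glue_cases w with ⟨a, rfl⟩ | ⟨q, hq, rfl⟩
  · obtain ⟨T, cT, lT, dT⟩ := hJ.exists_notMem
    by_cases ha : a = P.right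
    · subst ha
      obtain ⟨S₁, c₁, r₁, d₁⟩ := hP.exists_notMem
      refine ⟨glueUnion S₁ T, ?_, ?_, forall_isTotallyDominated_glueUnion
          (fun a ha _ => d₁ a ha) (fun q hq _ => dT q hq) (fun h => absurd rfl h)⟩
      · have := card_glueUnion_le (S₁ := S₁) (S₂ := T)
        lia
      · rw [glueInl_mem_glueUnion]
        simp [r₁, lT]
    · obtain ⟨S₁, c₁, w₁, r₁, d₁⟩ := hP.exists_delete a ha
      by_cases hr : P.right ∈ S₁
      · obtain ⟨S₂, c₂, l₂, d₂⟩ := hJ.exists_mem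
        refine ⟨glueUnion S₁ S₂, ?_, ?_, forall_isTotallyDominated_glueUnion
            (fun b hb hb' => d₁ b (fun h => hb' (congrArg _ h)) hb)
            (fun q _ _ => d₂ q) (fun _ => .inr (d₂ _))⟩
        · have := card_glueUnion_lt hr l₂
          lia
        · rw [glueInl_mem_glueUnion]
          simp [w₁, ha]
      · refine ⟨glueUnion S₁ T, ?_, ?_, forall_isTotallyDominated_glueUnion
            (fun b hb hb' => d₁ b (fun h => hb' (congrArg _ h)) hb)
            (fun q hq _ => dT q hq) (fun _ => .inl (r₁.resolve_left hr))⟩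
        · have := card_glueUnion_le (S₁ := S₁) (S₂ := T)
          lia
        · rw [glueInl_mem_glueUnion]
          simp [w₁, ha]
  · have hne {r : J.V} (h : glueInr P J r ≠ glueInr P J q) : r ≠ q := fun h' =>
      h (congrArg _ h')
    rcases hJ.exists_delete q hq with ⟨S₂, c₂, w₂, l₂, d₂⟩ | ⟨S₂, c₂, w₂, l₂, d₂⟩
    · obtain ⟨S₁, c₁, r₁, d₁⟩ := hP.exists_mem
      refine ⟨glueUnion S₁ S₂, ?_, ?_, forall_isTotallyDominated_glueUnion
          (fun b _ _ => d₁ b) (fun r hr hr' => d₂ r (hne hr') hr) (fun _ => .inl (d₁ _))⟩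
      · have := card_glueUnion_lt r₁ l₂
        lia
      · rw [glueInr_mem_glueUnion]
        simp [w₂, hq]
    · obtain ⟨S₁, c₁, r₁, d₁⟩ := hP.exists_notMem
      refine ⟨glueUnion S₁ S₂, ?_, ?_, forall_isTotallyDominated_glueUnion
          (fun b hb _ => d₁ b hb) (fun r _ hr => d₂ r (hne hr)) (fun _ => .inr (d₂ _ hq.symm))⟩
      · have := card_glueUnion_le (S₁ := S₁) (S₂ := S₂)
        lia
      · rw [glueInr_mem_glueUnion]
        simp [w₂, hq]

lemma IsChainPrefix.glue_end_walk (hP : P.IsChainPrefix k) (hJ : J.IsChainEnd)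
    (x y : (glue P J).V) : WalkWithin (glue P J).graph (5 * k + 7) x y := by
  rcases glue_cases x with ⟨a, rfl⟩ | ⟨q, hq, rfl⟩ <;>
    rcases glue_cases y with ⟨b, rfl⟩ | ⟨r, hr, rfl⟩
  · exact WalkWithin.glueInl J (hP.walk a b)
  · exact (WalkWithin.glue (hP.walk_right a) (hJ.walk_left _)).mono (by lia)
  · exact (WalkWithin.glue (hP.walk_right b) (hJ.walk_left _)).symm.mono (by lia)
  · refine WalkWithin.glueInr P ?_
    by_cases hq' : q = J.right
    · by_cases hr' : r = J.right
      · rw [hq', hr']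
        exact .refl _ _ _
      · exact ((hJ.walk_left q).symm.trans (hJ.walk_left_of_ne r hr')).mono (by lia)
    · exact ((hJ.walk_left_of_ne q hq').symm.trans (hJ.walk_left r)).mono (by lia)

end Glue

/-! ### Chains of arbitrary length -/

lemma IsChainLink.pow_right_ne_left {Q : PointedGraph.{u}} (hQ : Q.IsChainLink) (n : ℕ) :
    (pow Q (n + 1)).right ≠ (pow Q (n + 1)).left := by
  cases n with
  | zero => exact hQ.right_ne_left
  | succ n => exact (glueInl_ne_right hQ.right_ne_left _).symm

lemma IsChainPrefix.glue_pow {P : PointedGraph.{u}} {Q : PointedGraph.{v}}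
    (hP : P.IsChainPrefix 0) (hQ : Q.IsChainLink) (n : ℕ) :
    (glue P (pow Q n)).IsChainPrefix n := by
  induction n with
  | zero => exact hP.of_iso (gluePoint P) rfl (gluePoint_right P)
  | succ n ih =>
    cases n with
    | zero => exact hP.glue_link hQ
    | succ n =>
      -- The power brackets its own factors first, whereas the induction adds the last link to the
      -- whole prefix; associativity reconciles the two.
      exact (ih.glue_link hQ).of_iso (glueAssoc P (pow Q (n + 1)) Q (hQ.pow_right_ne_left n))
        (glueAssoc_left _ _ _ _) (glueAssoc_right _ _ _ _ hQ.right_ne_left)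

end PointedGraph

/-! ### Cardinality from distinct elements -/

lemma Finset.four_le_card {α : Type*} {S : Finset α} {a b c d : α} (ha : a ∈ S) (hb : b ∈ S)
    (hc : c ∈ S) (hd : d ∈ S) (hab : a ≠ b) (hac : a ≠ c) (had : a ≠ d) (hbc : b ≠ c)
    (hbd : b ≠ d) (hcd : c ≠ d) : 4 ≤ S.card := by
  classical
  have h : ({a, b, c, d} : Finset α).card = 4 := by
    rw [Finset.card_eq_succ]
    exact ⟨a, {b, c, d}, by simp [hab, hac, had], rfl, Finset.card_eq_three.2
      ⟨b, c, d, hbc, hbd, hcd, rfl⟩⟩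
  rw [← h]
  exact Finset.card_le_card (by simp [Finset.insert_subset_iff, *])

lemma Finset.three_le_card {α : Type*} {S : Finset α} {a b c : α} (ha : a ∈ S) (hb : b ∈ S)
    (hc : c ∈ S) (hab : a ≠ b) (hac : a ≠ c) (hbc : b ≠ c) : 3 ≤ S.card :=
  Finset.two_lt_card.2 ⟨a, ha, b, hb, c, hc, hab, hac, hbc⟩

/-! ### The pointed graph `Q` -/

namespace QVert

variable {W : Type u} {H : SimpleGraph W} {S : Finset (QVert W)} {a : W}

lemma exists_iff {p : QVert W → Prop} : (∃ x, p x) ↔ p left ∨ (∃ w, p (x1 w)) ∨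
    (∃ w, p (y1 w)) ∨ (∃ w, p (x2 w)) ∨ (∃ w, p (y2 w)) ∨ p right := by
  constructor
  · rintro ⟨_ | w | w | w | w | _, h⟩ <;> grind
  · grind

lemma dominated_left : IsTotallyDominated (SimpleGraph.fromRel (QRel H)) S left ↔
    ∃ b, x1 b ∈ S := by
  simp [IsTotallyDominated, exists_iff, QRel]

lemma dominated_x1 : IsTotallyDominated (SimpleGraph.fromRel (QRel H)) S (x1 a) ↔
    left ∈ S ∨ (∃ b, x1 b ∈ S ∧ H.Adj a b) ∨ ∃ b, y1 b ∈ S ∧ a ≠ b := by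
  simp [IsTotallyDominated, exists_iff, QRel, H.adj_comm _ a]
  grind [H.ne_of_adj]

lemma dominated_y1 : IsTotallyDominated (SimpleGraph.fromRel (QRel H)) S (y1 a) ↔
    (∃ b, x1 b ∈ S ∧ b ≠ a) ∨ (∃ b, y1 b ∈ S ∧ a ≠ b ∧ ¬ H.Adj a b) ∨ ∃ b, x2 b ∈ S := by
  simp [IsTotallyDominated, exists_iff, QRel, H.adj_comm _ a]
  grind

lemma dominated_x2 : IsTotallyDominated (SimpleGraph.fromRel (QRel H)) S (x2 a) ↔
    (∃ b, y1 b ∈ S) ∨ (∃ b, x2 b ∈ S ∧ H.Adj a b) ∨ ∃ b, y2 b ∈ S ∧ a ≠ b := by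
  simp [IsTotallyDominated, exists_iff, QRel, H.adj_comm _ a]
  grind [H.ne_of_adj]

lemma dominated_y2 : IsTotallyDominated (SimpleGraph.fromRel (QRel H)) S (y2 a) ↔
    (∃ b, x2 b ∈ S ∧ b ≠ a) ∨ (∃ b, y2 b ∈ S ∧ a ≠ b ∧ ¬ H.Adj a b) ∨ right ∈ S := by
  simp [IsTotallyDominated, exists_iff, QRel, H.adj_comm _ a]
  grind

lemma dominated_right : IsTotallyDominated (SimpleGraph.fromRel (QRel H)) S right ↔
    ∃ b, y2 b ∈ S := by
  simp [IsTotallyDominated, exists_iff, QRel]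

section LowerBound

variable [DecidableEq (QVert W)]

/-- A single interior vertex is not enough: one in the copies `y1`, `x2` does not dominate itself,
and one in `x1` does not reach `x2`. Right is erased so that its membership can be charged
separately. -/
lemma two_le_card [Nonempty W]
    (h : ∀ x, x ≠ left → x ≠ right → IsTotallyDominated (SimpleGraph.fromRel (QRel H)) S x) :
    2 ≤ ((S.erase left).erase right).card := by
  obtain ⟨w⟩ := ‹Nonempty W›
  have hy := fun a => dominated_y1.1 (h (y1 a) (by simp) (by simp))
  have hx := fun a => dominated_x2.1 (h (x2 a) (by simp) (by simp))
  have key (c d : QVert W) (hc : c ∈ S) (hd : d ∈ S) (hc' : c ≠ left ∧ c ≠ right)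
      (hd' : d ≠ left ∧ d ≠ right) (hcd : c ≠ d) : 2 ≤ ((S.erase left).erase right).card :=
    Finset.one_lt_card.2 ⟨c, by simp [*], d, by simp [*], hcd⟩
  rcases hy w with ⟨b, hb, -⟩ | ⟨b, hb, -⟩ | ⟨b, hb⟩
  · rcases hx w with ⟨c, hc⟩ | ⟨c, hc, -⟩ | ⟨c, hc, -⟩ <;>
      exact key _ _ hb hc (by simp) (by simp) (by simp)
  · rcases hy b with ⟨c, hc, -⟩ | ⟨c, hc, hbc, -⟩ | ⟨c, hc⟩ <;>
      exact key _ _ hb hc (by simp) (by simp) (by simp_all)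
  · rcases hx b with ⟨c, hc⟩ | ⟨c, hc, hbc⟩ | ⟨c, hc, -⟩
    · exact key _ _ hb hc (by simp) (by simp) (by simp)
    · exact key _ _ hb hc (by simp) (by simp) (by simpa using hbc.ne)
    · exact key _ _ hb hc (by simp) (by simp) (by simp)

/-- Dominating Left forces some `x1 a`. The only candidates for a second vertex that could suffice
are the `y1 b`, and `x1 a`, `y1 b` always miss something: `x1 a` if `a = b`, `y1 a` if `a` and `b`
are adjacent in `H`, and `x1 b` otherwise. -/
lemma three_le_card_of_left
    (h : ∀ x, x ≠ left → x ≠ right → IsTotallyDominated (SimpleGraph.fromRel (QRel H)) S x)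
    (hl : left ∉ S) (hd : IsTotallyDominated (SimpleGraph.fromRel (QRel H)) S left) :
    3 ≤ ((S.erase left).erase right).card := by
  obtain ⟨a, ha⟩ := dominated_left.1 hd
  have hx1 := fun a => (dominated_x1.1 (h (x1 a) (by simp) (by simp))).resolve_left hl
  have hy1 := fun a => dominated_y1.1 (h (y1 a) (by simp) (by simp))
  have hx2 := fun a => dominated_x2.1 (h (x2 a) (by simp) (by simp))
  have key (c d : QVert W) (hc : c ∈ S) (hd : d ∈ S) (hc' : c ≠ left ∧ c ≠ right ∧ x1 a ≠ c)
      (hd' : d ≠ left ∧ d ≠ right ∧ x1 a ≠ d) (hcd : c ≠ d) :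
      3 ≤ ((S.erase left).erase right).card :=
    Finset.three_le_card (a := x1 a) (b := c) (c := d) (by simp [*]) (by simp [*]) (by simp [*])
      hc'.2.2 hd'.2.2 hcd
  rcases hx2 a with ⟨b, hb⟩ | ⟨b, hb, -⟩ | ⟨b, hb, -⟩
  · by_cases hab : a = b
    · rcases hx1 a with ⟨c, hc, hac⟩ | ⟨c, hc, hac⟩
      · exact key _ _ hb hc (by simp) (by simpa using hac.ne) (by simp)
      · exact key _ _ hb hc (by simp) (by simp) (by simpa [← hab] using hac)
    · by_cases hH : H.Adj a b
      · rcases hy1 a with ⟨c, hc, hca⟩ | ⟨c, hc, hac, hH'⟩ | ⟨c, hc⟩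
        · exact key _ _ hb hc (by simp) (by simpa using hca.symm) (by simp)
        · exact key _ _ hb hc (by simp) (by simp) (by rintro ⟨⟩; exact hH' hH)
        · exact key _ _ hb hc (by simp) (by simp) (by simp)
      · rcases hx1 b with ⟨c, hc, hbc⟩ | ⟨c, hc, hbc⟩
        · exact key _ _ hb hc (by simp) ⟨by simp, by simp, by rintro ⟨⟩; exact hH hbc.symm⟩ (by simp)
        · exact key _ _ hb hc (by simp) (by simp) (by simpa using hbc)
  all_goals
    rcases hx1 a with ⟨c, hc, hac⟩ | ⟨c, hc, hac⟩
    · exact key _ _ hb hc (by simp) (by simpa using hac.ne) (by simp)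
    · exact key _ _ hb hc (by simp) (by simp) (by simp)

/-- The mirror image of `three_le_card_of_left`: reversing `Q` exchanges `H` and its complement. -/
lemma three_le_card_of_right
    (h : ∀ x, x ≠ left → x ≠ right → IsTotallyDominated (SimpleGraph.fromRel (QRel H)) S x)
    (hr : right ∉ S) (hd : IsTotallyDominated (SimpleGraph.fromRel (QRel H)) S right) :
    3 ≤ ((S.erase left).erase right).card := by
  obtain ⟨a, ha⟩ := dominated_right.1 hd
  have hy1 := fun a => dominated_y1.1 (h (y1 a) (by simp) (by simp))
  have hx2 := fun a => dominated_x2.1 (h (x2 a) (by simp) (by simp))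
  have hy2 := fun a => dominated_y2.1 (h (y2 a) (by simp) (by simp))
  simp only [hr, or_false] at hy2
  have key (c d : QVert W) (hc : c ∈ S) (hd : d ∈ S) (hc' : c ≠ left ∧ c ≠ right ∧ y2 a ≠ c)
      (hd' : d ≠ left ∧ d ≠ right ∧ y2 a ≠ d) (hcd : c ≠ d) :
      3 ≤ ((S.erase left).erase right).card :=
    Finset.three_le_card (a := y2 a) (b := c) (c := d) (by simp [*]) (by simp [*]) (by simp [*])
      hc'.2.2 hd'.2.2 hcd
  rcases hy1 a with ⟨b, hb, -⟩ | ⟨b, hb, -⟩ | ⟨b, hb⟩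
  -- The case of a vertex `x2 b` is the delicate one; in the other two, a neighbour of `y2 a` is
  -- automatically a third vertex.
  rotate_left 2
  · by_cases hab : a = b
    · rcases hy2 a with ⟨c, hc, hca⟩ | ⟨c, hc, hac, -⟩
      · exact key _ _ hb hc (by simp) (by simp) (by simpa [← hab] using hca.symm)
      · exact key _ _ hb hc (by simp) (by simpa using hac) (by simp)
    · by_cases hH : H.Adj a b
      · rcases hy2 b with ⟨c, hc, hcb⟩ | ⟨c, hc, hbc, hH'⟩
        · exact key _ _ hb hc (by simp) (by simp) (by simpa using hcb.symm)
        · exact key _ _ hb hc (by simp) ⟨by simp, by simp, by rintro ⟨⟩; exact hH' hH.symm⟩ (by simp)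
      · rcases hx2 a with ⟨c, hc⟩ | ⟨c, hc, hac⟩ | ⟨c, hc, hac⟩
        · exact key _ _ hb hc (by simp) (by simp) (by simp)
        · exact key _ _ hb hc (by simp) (by simp) (by rintro ⟨⟩; exact hH hac)
        · exact key _ _ hb hc (by simp) (by simpa using hac) (by simp)
  all_goals
    rcases hy2 a with ⟨c, hc, -⟩ | ⟨c, hc, hac, -⟩
    · exact key _ _ hb hc (by simp) (by simp) (by simp)
    · exact key _ _ hb hc (by simp) (by simpa using hac) (by simp)

/-- Some `x1 a` and some `y2 b` are needed, and without Left and Right each needs its own neighbour: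
one in the first two copies, one in the last two. -/
lemma four_le_card
    (h : ∀ x, x ≠ left → x ≠ right → IsTotallyDominated (SimpleGraph.fromRel (QRel H)) S x)
    (hl : left ∉ S) (hd : IsTotallyDominated (SimpleGraph.fromRel (QRel H)) S left)
    (hr : right ∉ S) (hd' : IsTotallyDominated (SimpleGraph.fromRel (QRel H)) S right) :
    4 ≤ ((S.erase left).erase right).card := by
  obtain ⟨a, ha⟩ := dominated_left.1 hd
  obtain ⟨b, hb⟩ := dominated_right.1 hd'
  have hx1 := (dominated_x1.1 (h (x1 a) (by simp) (by simp))).resolve_left hl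
  have hy2 := dominated_y2.1 (h (y2 b) (by simp) (by simp))
  simp only [hr, or_false] at hy2
  rcases hx1 with ⟨c, hc, hac⟩ | ⟨c, hc, -⟩ <;> rcases hy2 with ⟨d, hd, -⟩ | ⟨d, hd, hbd, -⟩ <;>
    refine Finset.four_le_card (a := x1 a) (b := y2 b) (by simp [*]) (by simp [*])
      (Finset.mem_erase.2 ⟨?_, Finset.mem_erase.2 ⟨?_, hc⟩⟩)
      (Finset.mem_erase.2 ⟨?_, Finset.mem_erase.2 ⟨?_, hd⟩⟩) ?_ ?_ ?_ ?_ ?_ ?_ <;>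
    first | simp; done | simpa using hac.ne | simpa using hbd

end LowerBound

end QVert

open QVert in
lemma graphQ_isChainLink {W : Type u} {H : SimpleGraph W} [Nonempty W]
    (hH : ∃ a b, a ≠ b ∧ ∀ w, H.Adj w a ∨ H.Adj w b)
    (hHc : ∃ a b, a ≠ b ∧ ∀ w, Hᶜ.Adj w a ∨ Hᶜ.Adj w b) : (graphQ H).IsChainLink := by
  classical
  have hadj (w : W) : ∃ a, H.Adj w a := by
    obtain ⟨a, b, -, h⟩ := hH
    exact (h w).elim (fun h => ⟨a, h⟩) fun h => ⟨b, h⟩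
  have hadjc (w : W) : ∃ a, w ≠ a ∧ ¬ H.Adj w a := by
    obtain ⟨a, b, -, h⟩ := hHc
    exact (h w).elim (fun h => ⟨a, h⟩) fun h => ⟨b, h⟩
  have erase_right (S : Finset (QVert W)) (hr : right ∈ S) :
      ((S.erase left).erase right).card + 1 = (S.erase left).card :=
    Finset.card_erase_add_one (by simp [hr])
  have erase_le (S : Finset (QVert W)) :
      ((S.erase left).erase right).card ≤ (S.erase left).card :=
    Finset.card_le_card (Finset.erase_subset _ _)
  unfold graphQ
  refine ⟨?_, ?_, ?_, ?_, ?_, ?_, ?_, ?_, ?_, ?_, ?_⟩ <;> dsimp only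
  · simp
  · intro S h
    have h₂ := two_le_card h
    refine ⟨h₂.trans (erase_le S), fun h' => ?_⟩
    by_cases hr : right ∈ S
    · exact (Nat.succ_le_succ h₂).trans_eq (erase_right S hr)
    · exact (three_le_card_of_right h hr (h'.resolve_left hr)).trans (erase_le S)
  · intro S h hl
    have hd := h left (by simp)
    have h' := fun x (_ : x ≠ left) (hx : x ≠ right) => h x hx
    have h₃ := three_le_card_of_left h' hl hd
    refine ⟨h₃.trans (erase_le S), fun h'' => ?_⟩
    by_cases hr : right ∈ S
    · exact (Nat.succ_le_succ h₃).trans_eq (erase_right S hr)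
    · exact (four_le_card h' hl hd hr (h''.resolve_left hr)).trans (erase_le S)
  · obtain ⟨a⟩ := ‹Nonempty W›
    obtain ⟨b, hab⟩ := hadj a
    -- With `a`, `b` adjacent in `H`, `y2 b` dominates its copy of `H` except `x2 b`, which `x2 a`
    -- dominates. The later witnesses with a pair of adjacent or nonadjacent vertices follow this
    -- pattern.
    refine ⟨({left, x2 a, y2 b, right} : Finset (QVert W)), Finset.card_le_four,
      by simp, by simp, ?_⟩
    have := hab.ne
    have := hab.symm
    rintro (_ | w | w | w | w | _) hx
    · exact absurd rfl hx
    · refine dominated_x1.2 ?_; simp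
    · refine dominated_y1.2 ?_; simp
    · refine dominated_x2.2 ?_; simp; grind
    · refine dominated_y2.2 ?_; simp
    · refine dominated_right.2 ?_; simp
  · obtain ⟨a, b, hab, h⟩ := hH
    refine ⟨({left, x2 a, x2 b} : Finset (QVert W)), Finset.card_le_three,
      by simp, by simp, ?_⟩
    rintro (_ | w | w | w | w | _) hx hx'
    · exact absurd rfl hx
    · refine dominated_x1.2 ?_; simp
    · refine dominated_y1.2 ?_; simp
    · refine dominated_x2.2 ?_; simp; grind
    · refine dominated_y2.2 ?_; simp; grind
    · exact absurd rfl hx'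
  · obtain ⟨a⟩ := ‹Nonempty W›
    obtain ⟨b, hab, hH⟩ := hadjc a
    refine ⟨({left, x1 a, y1 b, right} : Finset (QVert W)), Finset.card_le_four,
      by simp, by simp, ?_⟩
    rintro (_ | w | w | w | w | _) hx
    · refine dominated_left.2 ?_; simp
    · refine dominated_x1.2 ?_; simp
    · refine dominated_y1.2 ?_; simp; grind
    · refine dominated_x2.2 ?_; simp
    · refine dominated_y2.2 ?_; simp
    · exact absurd rfl hx
  · obtain ⟨a, b, hab, h⟩ := hHc
    simp only [SimpleGraph.compl_adj] at h
    refine ⟨({right, y1 a, y1 b} : Finset (QVert W)), Finset.card_le_three,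
      by simp, by simp, ?_⟩
    rintro (_ | w | w | w | w | _) hx hx'
    · exact absurd rfl hx
    · refine dominated_x1.2 ?_; simp; grind
    · refine dominated_y1.2 ?_; simp; grind
    · refine dominated_x2.2 ?_; simp
    · refine dominated_y2.2 ?_; simp
    · exact absurd rfl hx'
  -- The vertex corresponding to the deleted one in the paired copy is adjacent to all of the
  -- deleted vertex's copy except the deleted vertex. The second vertex `b` is chosen so that the
  -- one vertex it misses in the paired copy is dominated by the first.
  · rintro (_ | a | a | a | a | _) hx hx'
    · exact absurd rfl hx
    · obtain ⟨b, hab, hH⟩ := hadjc a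
      refine .inl ⟨({right, y1 a, x1 b} : Finset (QVert W)), Finset.card_le_three,
        by simpa using hab, by simp, by simp, ?_⟩
      have := H.adj_comm a b
      rintro (_ | w | w | w | w | _) hx hx'
      · refine dominated_left.2 ?_; simp
      · refine dominated_x1.2 ?_; simp; grind
      · refine dominated_y1.2 ?_; simp; grind
      · refine dominated_x2.2 ?_; simp
      · refine dominated_y2.2 ?_; simp
      · exact absurd rfl hx'
    · obtain ⟨b, hab⟩ := hadj a
      refine .inl ⟨({right, x1 a, y1 b} : Finset (QVert W)), Finset.card_le_three,
        by simpa using hab.ne, by simp, by simp, ?_⟩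
      have := H.adj_comm a b
      rintro (_ | w | w | w | w | _) hx hx'
      · refine dominated_left.2 ?_; simp
      · refine dominated_x1.2 ?_; simp; grind
      · refine dominated_y1.2 ?_; simp; grind
      · refine dominated_x2.2 ?_; simp
      · refine dominated_y2.2 ?_; simp
      · exact absurd rfl hx'
    · obtain ⟨b, hab, hH⟩ := hadjc a
      refine .inr ⟨({left, y2 a, x2 b} : Finset (QVert W)), Finset.card_le_three,
        by simpa using hab, by simp, ?_⟩
      have := H.adj_comm a b
      rintro (_ | w | w | w | w | _) hx hx'
      · exact absurd rfl hx'
      · refine dominated_x1.2 ?_; simp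
      · refine dominated_y1.2 ?_; simp
      · refine dominated_x2.2 ?_; simp; grind
      · refine dominated_y2.2 ?_; simp; grind
      · refine dominated_right.2 ?_; simp
    · obtain ⟨b, hab⟩ := hadj a
      refine .inr ⟨({left, x2 a, y2 b} : Finset (QVert W)), Finset.card_le_three,
        by simpa using hab.ne, by simp, ?_⟩
      have := H.adj_comm a b
      rintro (_ | w | w | w | w | _) hx hx'
      · exact absurd rfl hx'
      · refine dominated_x1.2 ?_; simp
      · refine dominated_y1.2 ?_; simp
      · refine dominated_x2.2 ?_; simp; grind
      · refine dominated_y2.2 ?_; simp; grind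
      · refine dominated_right.2 ?_; simp
    · exact absurd rfl hx'
  · obtain ⟨w⟩ := ‹Nonempty W›
    have hx₁ (a : W) : WalkWithin (SimpleGraph.fromRel (QRel H)) 1 left (x1 a) :=
      .cons (by simp [QRel]) (.refl _ _ _)
    have hy₁ (a : W) : WalkWithin (SimpleGraph.fromRel (QRel H)) 2 left (y1 a) := by
      obtain ⟨b, hab⟩ := hadj a
      exact (hx₁ b).snoc (by simpa [QRel] using hab.ne')
    have hx₂ (a : W) : WalkWithin (SimpleGraph.fromRel (QRel H)) 3 left (x2 a) :=
      (hy₁ w).snoc (by simp [QRel])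
    have hy₂ (a : W) : WalkWithin (SimpleGraph.fromRel (QRel H)) 4 left (y2 a) := by
      obtain ⟨b, hab⟩ := hadj a
      exact (hx₂ b).snoc (by simpa [QRel] using hab.ne')
    rintro (_ | a | a | a | a | _)
    · exact .refl _ _ _
    · exact (hx₁ a).mono (by simp)
    · exact (hy₁ a).mono (by simp)
    · exact (hx₂ a).mono (by simp)
    · exact (hy₂ a).mono (by simp)
    · exact (hy₂ w).snoc (by simp [QRel])
  · obtain ⟨w⟩ := ‹Nonempty W›
    have hy₂ (a : W) : WalkWithin (SimpleGraph.fromRel (QRel H)) 1 (y2 a) right :=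
      .cons (by simp [QRel]) (.refl _ _ _)
    have hx₂ (a : W) : WalkWithin (SimpleGraph.fromRel (QRel H)) 2 (x2 a) right := by
      obtain ⟨b, hab⟩ := hadj a
      exact .cons (by simpa [QRel] using hab.ne) (hy₂ b)
    have hy₁ (a : W) : WalkWithin (SimpleGraph.fromRel (QRel H)) 3 (y1 a) right :=
      .cons (by simp [QRel]) (hx₂ w)
    have hx₁ (a : W) : WalkWithin (SimpleGraph.fromRel (QRel H)) 4 (x1 a) right := by
      obtain ⟨b, hab⟩ := hadj a
      exact .cons (by simpa [QRel] using hab.ne) (hy₁ b)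
    rintro (_ | a | a | a | a | _)
    · exact .cons (by simp [QRel]) (hx₁ w)
    · exact (hx₁ a).mono (by simp)
    · exact (hy₁ a).mono (by simp)
    · exact (hx₂ a).mono (by simp)
    · exact (hy₂ a).mono (by simp)
    · exact .refl _ _ _
  · refine ⟨fun x : QVert W => match x with
      | .left => 0 | .x1 _ => 1 | .y1 _ => 2 | .x2 _ => 3 | .y2 _ => 4 | .right => 5,
      rfl, rfl, ?_⟩
    rintro (_ | a | a | a | a | _) (_ | b | b | b | b | _) h <;> simp [QRel] at h ⊢

/-! ### The pointed graph `R` -/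

namespace RVert

variable {m : ℕ} {S : Finset (RVert m)} {i : Fin (2 * m)}

lemma exists_iff {p : RVert m → Prop} : (∃ s, p s) ↔ (∃ i, p (x i)) ∨ (∃ i, p (y i)) ∨
    p z1 ∨ p z2 ∨ p z3 ∨ p left ∨ p right := by
  constructor
  · rintro ⟨i | i | _ | _ | _ | _ | _, h⟩ <;> grind
  · grind

lemma dominated_left : IsTotallyDominated (SimpleGraph.fromRel (RRel m)) S left ↔
    ∃ j, x j ∈ S := by
  simp [IsTotallyDominated, exists_iff, RRel]

lemma dominated_x : IsTotallyDominated (SimpleGraph.fromRel (RRel m)) S (x i) ↔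
    (∃ j, x j ∈ S ∧ i ≠ j ∧ ¬ (graphF m).Adj i j) ∨ (∃ j, y j ∈ S ∧ i ≠ j) ∨
      (z1 ∈ S ∧ i.val + 1 ≠ 2 * m) ∨ (z2 ∈ S ∧ i.val ≠ 0) ∨ left ∈ S := by
  simp [IsTotallyDominated, exists_iff, RRel, (graphF m).adj_comm _ i]
  grind

lemma dominated_y : IsTotallyDominated (SimpleGraph.fromRel (RRel m)) S (y i) ↔
    (∃ j, x j ∈ S ∧ i ≠ j) ∨ (∃ j, y j ∈ S ∧ i.val % 2 ≠ j.val % 2) ∨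
      (z1 ∈ S ∧ i.val ≠ 0 ∧ i.val + 1 ≠ 2 * m) ∨ (z2 ∈ S ∧ i.val ≠ 0 ∧ i.val + 1 ≠ 2 * m) ∨
      z3 ∈ S ∨ right ∈ S := by
  simp [IsTotallyDominated, exists_iff, RRel, graphK]
  grind

lemma dominated_z1 : IsTotallyDominated (SimpleGraph.fromRel (RRel m)) S z1 ↔
    (∃ j, x j ∈ S ∧ j.val + 1 ≠ 2 * m) ∨ (∃ j, y j ∈ S ∧ j.val ≠ 0 ∧ j.val + 1 ≠ 2 * m) ∨
      z3 ∈ S := by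
  simp [IsTotallyDominated, exists_iff, RRel]

lemma dominated_z2 : IsTotallyDominated (SimpleGraph.fromRel (RRel m)) S z2 ↔
    (∃ j, x j ∈ S ∧ j.val ≠ 0) ∨ (∃ j, y j ∈ S ∧ j.val ≠ 0 ∧ j.val + 1 ≠ 2 * m) ∨
      right ∈ S := by
  simp [IsTotallyDominated, exists_iff, RRel]

lemma dominated_z3 : IsTotallyDominated (SimpleGraph.fromRel (RRel m)) S z3 ↔
    (∃ j, y j ∈ S) ∨ z1 ∈ S := by
  simp [IsTotallyDominated, exists_iff, RRel]

lemma dominated_right : IsTotallyDominated (SimpleGraph.fromRel (RRel m)) S right ↔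
    (∃ j, y j ∈ S) ∨ z2 ∈ S := by
  simp [IsTotallyDominated, exists_iff, RRel]

lemma graphF_adj {i j : Fin (2 * m)} : (graphF m).Adj i j ↔ i.val % 2 ≠ j.val % 2 ∧
    ¬ (i.val = 0 ∧ j.val + 1 = 2 * m) ∧ ¬ (j.val = 0 ∧ i.val + 1 = 2 * m) := Iff.rfl

lemma two_le_card [DecidableEq (RVert m)]
    (h : ∀ s, s ≠ right → IsTotallyDominated (SimpleGraph.fromRel (RRel m)) S s) :
    2 ≤ (S.erase right).card := by
  obtain ⟨i, hi⟩ := dominated_left.1 (h left (by simp))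
  have key (s : RVert m) (hs : s ∈ S) (hs' : s ≠ right ∧ x i ≠ s) : 2 ≤ (S.erase right).card :=
    Finset.one_lt_card.2 ⟨x i, by simp [*], s, by simp [*], hs'.2⟩
  rcases dominated_x.1 (h (x i) (by simp)) with
    ⟨j, hj, hij, -⟩ | ⟨j, hj, -⟩ | ⟨hs, -⟩ | ⟨hs, -⟩ | hs
  · exact key _ hj (by simpa using hij)
  · exact key _ hj (by simp)
  · exact key _ hs (by simp)
  · exact key _ hs (by simp)
  · exact key _ hs (by simp)

/-- If `x i` and `y j` sufficed, dominating `x i`, `x j` and `y i` would make `ij` an edge of the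
complete bipartite graph missing from `graphF`, so `i` and `j` are the first and last index. Then
`z1` or `z2` is undominated: this is what the removed edge and these two vertices are for. If Right
is dominated by `z2` instead, `z3` needs a third vertex. -/
lemma three_le_card
    (h : ∀ s, IsTotallyDominated (SimpleGraph.fromRel (RRel m)) S s) (hr : right ∉ S) :
    3 ≤ S.card := by
  obtain ⟨i, hi⟩ := dominated_left.1 (h left)
  rcases dominated_right.1 (h right) with ⟨j, hj⟩ | hz
  · have key (s : RVert m) (hs : s ∈ S) (hx : x i ≠ s) (hy : y j ≠ s) : 3 ≤ S.card :=
      Finset.three_le_card hi hj hs (by simp) hx hy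
    have hx := fun i => dominated_x.1 (h (x i))
    have hy := fun i => dominated_y.1 (h (y i))
    have hz₁ := dominated_z1.1 (h z1)
    have hz₂ := dominated_z2.1 (h z2)
    by_contra hcard
    have hxS (l : Fin (2 * m)) (hl : x l ∈ S) : l = i := by
      by_contra hne
      exact hcard (key _ hl (by simpa using Ne.symm hne) (by simp))
    have hyS (l : Fin (2 * m)) (hl : y l ∈ S) : l = j := by
      by_contra hne
      exact hcard (key _ hl (by simp) (by simpa using Ne.symm hne))
    have h₁ : z1 ∉ S := fun hs => hcard (key _ hs (by simp) (by simp))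
    have h₂ : z2 ∉ S := fun hs => hcard (key _ hs (by simp) (by simp))
    have h₃ : z3 ∉ S := fun hs => hcard (key _ hs (by simp) (by simp))
    have h₄ : left ∉ S := fun hs => hcard (key _ hs (by simp) (by simp))
    simp only [h₁, h₂, h₃, h₄, hr, false_and, or_false] at hx hy hz₁ hz₂
    have hij : i ≠ j := by
      rcases hx i with ⟨l, hl, hil, -⟩ | ⟨l, hl, hil⟩
      · exact absurd (hxS l hl).symm hil
      · exact hyS l hl ▸ hil
    have hF : ¬ (graphF m).Adj j i := by
      rcases hx j with ⟨l, hl, -, hil⟩ | ⟨l, hl, hil⟩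
      · exact hxS l hl ▸ hil
      · exact absurd (hyS l hl).symm hil
    have hK : i.val % 2 ≠ j.val % 2 := by
      rcases hy i with ⟨l, hl, hil⟩ | ⟨l, hl, hil⟩
      · exact absurd (hxS l hl).symm hil
      · exact hyS l hl ▸ hil
    have hz₁' : i.val + 1 ≠ 2 * m ∨ j.val ≠ 0 ∧ j.val + 1 ≠ 2 * m := by
      rcases hz₁ with ⟨l, hl, hil⟩ | ⟨l, hl, hil⟩
      · exact .inl (hxS l hl ▸ hil)
      · exact .inr (hyS l hl ▸ hil)
    have hz₂' : i.val ≠ 0 ∨ j.val ≠ 0 ∧ j.val + 1 ≠ 2 * m := by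
      rcases hz₂ with ⟨l, hl, hil⟩ | ⟨l, hl, hil⟩
      · exact .inl (hxS l hl ▸ hil)
      · exact .inr (hyS l hl ▸ hil)
    rw [graphF_adj] at hF
    lia
  · rcases dominated_z3.1 (h z3) with ⟨j, hj⟩ | hj <;>
      exact Finset.three_le_card hi hz hj (by simp) (by simp) (by simp)

lemma exists_delete (hm : 2 ≤ m) (w : RVert m) (hw : w ≠ right) :
    ∃ S : Finset (RVert m), S.card ≤ 2 ∧ w ∉ S ∧
      ∀ s, s ≠ w → IsTotallyDominated (SimpleGraph.fromRel (RRel m)) S s := by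
  classical
  -- A pair `x i`, `y j` works once the vertices it could miss, `x j`, `y i`, `z1` and `z2`, are
  -- dominated or deleted.
  have hxy (i j : Fin (2 * m)) (w : RVert m) (hij : i ≠ j) (hw : w ≠ x i ∧ w ≠ y j)
      (hx : x j ≠ w → ¬ (graphF m).Adj j i) (hy : y i ≠ w → i.val % 2 ≠ j.val % 2)
      (hz₁ : z1 ≠ w → i.val + 1 ≠ 2 * m ∨ j.val ≠ 0 ∧ j.val + 1 ≠ 2 * m)
      (hz₂ : z2 ≠ w → i.val ≠ 0 ∨ j.val ≠ 0 ∧ j.val + 1 ≠ 2 * m) :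
      ∃ S : Finset (RVert m), S.card ≤ 2 ∧ w ∉ S ∧
        ∀ s, s ≠ w → IsTotallyDominated (SimpleGraph.fromRel (RRel m)) S s := by
    refine ⟨{x i, y j}, Finset.card_le_two, by simpa using hw, ?_⟩
    rintro (l | l | _ | _ | _ | _ | _) hs
    · refine dominated_x.2 ?_
      simp; grind
    · refine dominated_y.2 ?_
      simp; grind
    · exact dominated_z1.2 (by simpa using hz₁ hs)
    · exact dominated_z2.2 (by simpa using hz₂ hs)
    · exact dominated_z3.2 (by simp)
    · exact dominated_left.2 (by simp)
    · exact dominated_right.2 (by simp)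
  simp only [graphF_adj, ne_eq, Fin.ext_iff] at hxy
  rcases w with a | a | _ | _ | _ | _ | _
  -- The deleted vertex is `x j`; the index `i` is of opposite parity and neither first nor last,
  -- using `2 ≤ m`.
  · refine hxy ⟨if a.val % 2 = 0 then 1 else 2, by split <;> lia⟩ a _ ?_ ?_ ?_ ?_ ?_ ?_ <;>
      simp [Fin.ext_iff] <;> split <;> lia
  -- The deleted vertex is `y i`; the index `j` has the same parity as `i`, and is interior whenever
  -- `i` is first or last.
  · refine hxy a ⟨if a.val % 2 = 0 then (if a.val = 0 then 2 else 0)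
      else (if a.val = 1 then 3 else 1), by split_ifs <;> lia⟩ _ ?_ ?_ ?_ ?_ ?_ ?_ <;>
      simp [Fin.ext_iff] <;> split_ifs <;> lia
  -- The two orientations of the removed edge fail only at `z1` and only at `z2`, respectively.
  · exact hxy ⟨2 * m - 1, by lia⟩ ⟨0, by lia⟩ _ (by simp; lia) (by simp) (by simp; lia)
      (by simp; lia) (by simp) (by simp; lia)
  · exact hxy ⟨0, by lia⟩ ⟨2 * m - 1, by lia⟩ _ (by simp; lia) (by simp) (by simp; lia)
      (by simp; lia) (by simp; lia) (by simp)
  -- The index 2 is interior and even: `x 2` dominates `x 0`, the only `x` missed by `z2`, while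
  -- `z2` dominates `y 2`, the only `y` missed by `x 2`.
  · obtain ⟨b, hb⟩ : ∃ i : Fin (2 * m), i.val = 2 := ⟨⟨2, by lia⟩, rfl⟩
    refine ⟨{x b, z2}, Finset.card_le_two, by simp, ?_⟩
    rintro (l | l | _ | _ | _ | _ | _) hs
    · refine dominated_x.2 ?_
      simp [graphF_adj]; lia
    · refine dominated_y.2 ?_
      simp; lia
    · exact dominated_z1.2 (by simp; lia)
    · exact dominated_z2.2 (by simp; lia)
    · exact absurd rfl hs
    · exact dominated_left.2 (by simp)
    · exact dominated_right.2 (by simp)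
  · obtain ⟨a, ha⟩ : ∃ i : Fin (2 * m), i.val = 0 := ⟨⟨0, by lia⟩, rfl⟩
    obtain ⟨b, hb⟩ : ∃ i : Fin (2 * m), i.val = 1 := ⟨⟨1, by lia⟩, rfl⟩
    refine ⟨{y a, y b}, Finset.card_le_two, by simp, ?_⟩
    rintro (l | l | _ | _ | _ | _ | _) hs
    · refine dominated_x.2 ?_
      simp; lia
    · refine dominated_y.2 ?_
      simp; lia
    · exact dominated_z1.2 (by simp; lia)
    · exact dominated_z2.2 (by simp; lia)
    · exact dominated_z3.2 (by simp)
    · exact absurd rfl hs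
    · exact dominated_right.2 (by simp)
  · exact absurd rfl hw

end RVert

open RVert in
lemma graphR_isChainPrefix {m : ℕ} (hm : 2 ≤ m) : (graphR m).IsChainPrefix 0 := by
  classical
  have walk_right (s : RVert m) : WalkWithin (SimpleGraph.fromRel (RRel m)) 3 s right := by
    have hy (i : Fin (2 * m)) : WalkWithin (SimpleGraph.fromRel (RRel m)) 1 (y i) right :=
      .cons (by simp [RRel]) (.refl _ _ _)
    have hx (i : Fin (2 * m)) : WalkWithin (SimpleGraph.fromRel (RRel m)) 2 (x i) right :=
      .cons (y := y ⟨if i.val = 0 then 1 else 0, by split <;> lia⟩)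
        (by simp [RRel, Fin.ext_iff]; split <;> lia) (hy _)
    rcases s with i | i | _ | _ | _ | _ | _
    · exact (hx i).mono (by simp)
    · exact (hy i).mono (by simp)
    · exact .cons (y := x ⟨0, by lia⟩) (by simp [RRel]; lia) (hx _)
    · exact .cons (y := right) (by simp [RRel]) (.refl _ _ _)
    · exact .mono (.cons (by simp [RRel]) (hy ⟨0, by lia⟩)) (by simp)
    · exact .cons (by simp [RRel]) (hx ⟨0, by lia⟩)
    · exact .refl _ _ _
  unfold graphR
  refine ⟨?_, ?_, ?_, ?_, ?_, ?_, ?_⟩ <;> dsimp only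
  · intro S h
    have h₂ := two_le_card h
    have hle := Finset.card_le_card (Finset.erase_subset right S)
    refine ⟨by lia, fun h' => ?_⟩
    by_cases hr : right ∈ S
    · have := Finset.card_erase_add_one hr
      lia
    · refine three_le_card (fun s => ?_) hr
      by_cases hs : s = right
      · exact hs ▸ h'.resolve_left hr
      · exact h s hs
  · obtain ⟨a, ha⟩ : ∃ i : Fin (2 * m), i.val = 0 := ⟨⟨0, by lia⟩, rfl⟩
    obtain ⟨b, hb⟩ : ∃ i : Fin (2 * m), i.val = 2 := ⟨⟨2, by lia⟩, rfl⟩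
    refine ⟨{right, x a, y b}, Finset.card_le_three, by simp, ?_⟩
    rintro (l | l | _ | _ | _ | _ | _)
    · refine dominated_x.2 ?_
      simp [graphF_adj]; lia
    · exact dominated_y.2 (by simp)
    · exact dominated_z1.2 (by simp; lia)
    · exact dominated_z2.2 (by simp)
    · exact dominated_z3.2 (by simp)
    · exact dominated_left.2 (by simp)
    · exact dominated_right.2 (by simp)
  -- The index 1 is interior and has the parity of the last one: `x 1` dominates the last `x`, which
  -- `z1` misses, and `z1` dominates `y 1`.
  · obtain ⟨a, ha⟩ : ∃ i : Fin (2 * m), i.val = 1 := ⟨⟨1, by lia⟩, rfl⟩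
    refine ⟨{z1, x a}, Finset.card_le_two, by simp, ?_⟩
    rintro (l | l | _ | _ | _ | _ | _) hs
    · refine dominated_x.2 ?_
      simp [graphF_adj]; lia
    · refine dominated_y.2 ?_
      simp; lia
    · exact dominated_z1.2 (by simp; lia)
    · exact dominated_z2.2 (by simp; lia)
    · exact dominated_z3.2 (by simp)
    · exact dominated_left.2 (by simp)
    · exact absurd rfl hs
  · intro w hw
    obtain ⟨S, hc, hS, h⟩ := exists_delete hm w hw
    exact ⟨S, hc, hS, .inr (h _ hw.symm), fun s hs _ => h s hs⟩
  · exact walk_right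
  · exact fun s t => ((walk_right s).trans (walk_right t).symm).mono (by simp)
  · refine ⟨fun s => match s with
      | .left => 0 | .x _ => 1 | .y _ => 2 | .z1 => 2 | .z2 => 2 | .z3 => 3 | .right => 3,
      rfl, rfl, ?_⟩
    rintro (_ | _ | _ | _ | _ | _ | _) (_ | _ | _ | _ | _ | _ | _) h <;> simp [RRel] at h ⊢

/-! ### The pointed graph `J` -/

namespace JVert

variable {t : ℕ} {S : Finset (JVert t)} {p : Fin t × Bool}

/-- The other vertex of the edge of `tK₂` containing `p`. -/
def mate (p : Fin t × Bool) : Fin t × Bool := (p.1, !p.2)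

lemma mate_mate (p : Fin t × Bool) : mate (mate p) = p := by simp [mate]

lemma mate_ne (p : Fin t × Bool) : mate p ≠ p := by simp [mate, Prod.ext_iff]

lemma adj_iff {p q : Fin t × Bool} : (graphTK2 t).Adj p q ↔ q = mate p := by
  rcases p with ⟨i, _ | _⟩ <;> rcases q with ⟨j, _ | _⟩ <;>
    simp [graphTK2, mate, Prod.ext_iff, eq_comm]

lemma eq_mate_comm {p q : Fin t × Bool} : p = mate q ↔ q = mate p := by
  constructor <;> rintro rfl <;> rw [mate_mate]

lemma exists_ne_mate (ht : 2 ≤ t) (p : Fin t × Bool) : ∃ q, q ≠ p ∧ q ≠ mate p := by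
  have : Nontrivial (Fin t) := Fin.nontrivial_iff_two_le.2 ht
  obtain ⟨i, hi⟩ := exists_ne p.1
  exact ⟨(i, true), fun h => hi (congrArg Prod.fst h), fun h => hi (congrArg Prod.fst h)⟩

lemma exists_iff {P : JVert t → Prop} : (∃ s, P s) ↔
    P left ∨ (∃ p, P (j1 p)) ∨ (∃ p, P (j2 p)) ∨ (∃ p, P (j3 p)) ∨ P right := by
  constructor
  · rintro ⟨_ | p | p | p | _, h⟩ <;> grind
  · grind

lemma dominated_left : IsTotallyDominated (SimpleGraph.fromRel (JRel t)) S left ↔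
    ∃ q, j1 q ∈ S := by
  simp only [IsTotallyDominated, exists_iff, SimpleGraph.fromRel_adj, JRel]
  simp [-Prod.exists]

lemma dominated_j1 : IsTotallyDominated (SimpleGraph.fromRel (JRel t)) S (j1 p) ↔
    left ∈ S ∨ j1 (mate p) ∈ S ∨ ∃ q, j2 q ∈ S ∧ q ≠ p := by
  simp only [IsTotallyDominated, exists_iff, SimpleGraph.fromRel_adj, JRel, adj_iff]
  simp [-Prod.exists]
  grind [eq_mate_comm, mate_ne]

lemma dominated_j2 : IsTotallyDominated (SimpleGraph.fromRel (JRel t)) S (j2 p) ↔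
    (∃ q, j1 q ∈ S ∧ q ≠ p) ∨ (∃ q, j2 q ∈ S ∧ q ≠ p ∧ q ≠ mate p) ∨
      ∃ q, j3 q ∈ S ∧ q ≠ p := by
  simp only [IsTotallyDominated, exists_iff, SimpleGraph.fromRel_adj, JRel, adj_iff,
    SimpleGraph.compl_adj]
  simp [-Prod.exists]
  grind [eq_mate_comm]

lemma dominated_j3 : IsTotallyDominated (SimpleGraph.fromRel (JRel t)) S (j3 p) ↔
    (∃ q, j2 q ∈ S ∧ q ≠ p) ∨ j3 (mate p) ∈ S ∨ right ∈ S := by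
  simp only [IsTotallyDominated, exists_iff, SimpleGraph.fromRel_adj, JRel, adj_iff]
  simp [-Prod.exists]
  grind [eq_mate_comm, mate_ne]

lemma dominated_right : IsTotallyDominated (SimpleGraph.fromRel (JRel t)) S right ↔
    ∃ q, j3 q ∈ S := by
  simp only [IsTotallyDominated, exists_iff, SimpleGraph.fromRel_adj, JRel]
  simp [-Prod.exists]

/-- Dominating Right forces some `j3 p`, and `j3 p` needs a neighbour. Each choice leaves a vertex
undominated: for `j2 q` it is `j2 p` or `j3 q`, for `j3 (mate p)` it is a `j3` vertex on another
edge (so `2 ≤ t`), and for Right it is `j2 p`. Left does not help with these. -/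
lemma three_le_card [DecidableEq (JVert t)] (ht : 2 ≤ t)
    (h : ∀ s, s ≠ left → IsTotallyDominated (SimpleGraph.fromRel (JRel t)) S s) :
    3 ≤ (S.erase left).card := by
  obtain ⟨p, hp⟩ := dominated_right.1 (h right (by simp [-Prod.exists]))
  have h₂ := fun p => dominated_j2.1 (h (j2 p) (by simp [-Prod.exists]))
  have h₃ := fun p => dominated_j3.1 (h (j3 p) (by simp [-Prod.exists]))
  have key (c d : JVert t) (hc : c ∈ S) (hd : d ∈ S) (hc' : c ≠ left ∧ j3 p ≠ c)
      (hd' : d ≠ left ∧ j3 p ≠ d ∧ c ≠ d) : 3 ≤ (S.erase left).card :=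
    Finset.three_le_card (a := j3 p) (b := c) (c := d) (by simp [*]) (by simp [*]) (by simp [*])
      hc'.2 hd'.2.1 hd'.2.2
  rcases h₃ p with ⟨q, hq, hqp⟩ | hq | hr
  · by_cases hqm : q = mate p
    · rcases h₂ p with ⟨r, hr, hrp⟩ | ⟨r, hr, hrp, hrm⟩ | ⟨r, hr, hrp⟩
      · exact key _ _ hq hr (by simp) (by simp)
      · exact key _ _ hq hr (by simp) (by simp; grind)
      · exact key _ _ hq hr (by simp) (by simp; grind)
    · rcases h₃ q with ⟨r, hr, hrq⟩ | hr | hr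
      · exact key _ _ hq hr (by simp) (by simp; grind)
      · exact key _ _ hq hr (by simp) (by simp; grind [eq_mate_comm])
      · exact key _ _ hq hr (by simp) (by simp)
  · have hm := mate_ne p
    obtain ⟨q, hqp, hqm⟩ := exists_ne_mate ht p
    rcases h₃ q with ⟨r, hr, hrq⟩ | hr | hr
    · exact key _ _ hq hr (by simp; grind) (by simp)
    · exact key _ _ hq hr (by simp; grind) (by simp; grind [eq_mate_comm, mate_mate])
    · exact key _ _ hq hr (by simp; grind) (by simp)
  · rcases h₂ p with ⟨q, hq, hqp⟩ | ⟨q, hq, hqp, -⟩ | ⟨q, hq, hqp⟩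
    · exact key _ _ hr hq (by simp) (by simp)
    · exact key _ _ hr hq (by simp) (by simp)
    · exact key _ _ hr hq (by simp) (by simp; grind)

/-- Dominating Left and Right forces `j1 a` and `j3 p`. The only possible single common helper is a
`j2 q`, and one of `j3 p`, `j2 p`, `j3 q`, `j1 q` remains undominated, according to how `q` relates
to `a` and `p`. -/
lemma four_le_card (h : ∀ s, IsTotallyDominated (SimpleGraph.fromRel (JRel t)) S s)
    (hl : left ∉ S) : 4 ≤ S.card := by
  obtain ⟨a, ha⟩ := dominated_left.1 (h left)
  obtain ⟨p, hp⟩ := dominated_right.1 (h right)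
  have h₁ := fun p => dominated_j1.1 (h (j1 p))
  have h₂ := fun p => dominated_j2.1 (h (j2 p))
  have h₃ := fun p => dominated_j3.1 (h (j3 p))
  simp only [hl, false_or] at h₁
  have key (c d : JVert t) (hc : c ∈ S) (hd : d ∈ S) (hc' : j1 a ≠ c ∧ j3 p ≠ c)
      (hd' : j1 a ≠ d ∧ j3 p ≠ d ∧ c ≠ d) : 4 ≤ S.card :=
    Finset.four_le_card ha hp hc hd (by simp [-Prod.exists]) hc'.1 hd'.1 hc'.2 hd'.2.1 hd'.2.2
  have hma := mate_ne a
  have hmp := mate_ne p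
  rcases h₁ a with hc | ⟨q, hq, hqa⟩
  · rcases h₃ p with ⟨r, hr, -⟩ | hr | hr
    · exact key _ _ hc hr (by simp; grind) (by simp)
    · exact key _ _ hc hr (by simp; grind) (by simp; grind)
    · exact key _ _ hc hr (by simp; grind) (by simp)
  · by_cases hqp : q = p
    · rcases h₃ p with ⟨r, hr, hrp⟩ | hr | hr
      · exact key _ _ hq hr (by simp) (by simp; grind)
      · exact key _ _ hq hr (by simp) (by simp; grind)
      · exact key _ _ hq hr (by simp) (by simp)
    · by_cases hqa' : q = mate a
      · by_cases hqp' : q = mate p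
        · have hap : a = p := by rw [← mate_mate a, ← hqa', hqp', mate_mate]
          rcases h₂ p with ⟨r, hr, hrp⟩ | ⟨r, hr, hrp, hrm⟩ | ⟨r, hr, hrp⟩
          · exact key _ _ hq hr (by simp) (by simp; grind)
          · exact key _ _ hq hr (by simp) (by simp; grind)
          · exact key _ _ hq hr (by simp) (by simp; grind)
        · rcases h₃ q with ⟨r, hr, hrq⟩ | hr | hr
          · exact key _ _ hq hr (by simp) (by simp; grind)
          · exact key _ _ hq hr (by simp) (by simp; grind [eq_mate_comm])
          · exact key _ _ hq hr (by simp) (by simp)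
      · rcases h₁ q with hr | ⟨r, hr, hrq⟩
        · exact key _ _ hq hr (by simp) (by simp; grind [eq_mate_comm])
        · exact key _ _ hq hr (by simp) (by simp; grind)

end JVert

open JVert in
lemma graphJ_isChainEnd {t : ℕ} (ht : 2 ≤ t) : (graphJ t).IsChainEnd := by
  classical
  have : Nonempty (Fin t) := ⟨⟨0, by lia⟩⟩
  obtain ⟨o⟩ : Nonempty (Fin t × Bool) := inferInstance
  obtain ⟨o', ho, ho'⟩ := exists_ne_mate ht o
  have hmo := mate_ne o
  have hj₁ (p : Fin t × Bool) : WalkWithin (SimpleGraph.fromRel (JRel t)) 1 left (j1 p) :=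
    .cons (by simp [JRel]) (.refl _ _ _)
  have hj₂ (p : Fin t × Bool) : WalkWithin (SimpleGraph.fromRel (JRel t)) 2 left (j2 p) :=
    (hj₁ (mate p)).snoc (by simpa [JRel] using mate_ne p)
  have hj₃ (p : Fin t × Bool) : WalkWithin (SimpleGraph.fromRel (JRel t)) 3 left (j3 p) :=
    (hj₂ (mate p)).snoc (by simpa [JRel] using mate_ne p)
  unfold graphJ
  refine ⟨?_, ?_, ?_, ?_, ?_, ?_, ?_⟩ <;> dsimp only
  · intro S h
    refine ⟨three_le_card ht h, fun hl hd => ?_⟩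
    rw [Finset.erase_eq_of_notMem hl]
    refine four_le_card (fun s => ?_) hl
    by_cases hs : s = left
    · exact hs ▸ hd
    · exact h s hs
  · refine ⟨{left, right, j1 o, j3 (mate o)}, Finset.card_le_four, by simp, ?_⟩
    rintro (_ | p | p | p | _)
    · exact dominated_left.2 (by simp [-Prod.exists])
    · exact dominated_j1.2 (by simp [-Prod.exists])
    · refine dominated_j2.2 ?_
      simp [-Prod.exists]; grind
    · exact dominated_j3.2 (by simp [-Prod.exists])
    · exact dominated_right.2 (by simp [-Prod.exists])
  · refine ⟨{j2 o, j2 (mate o), j3 o'}, Finset.card_le_three, by simp, ?_⟩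
    rintro (_ | p | p | p | _) hs
    · exact absurd rfl hs
    · refine dominated_j1.2 ?_
      simp [-Prod.exists]; grind
    · refine dominated_j2.2 ?_
      simp [-Prod.exists]; grind [eq_mate_comm, mate_mate]
    · refine dominated_j3.2 ?_
      simp [-Prod.exists]; grind
    · exact dominated_right.2 (by simp [-Prod.exists])
  · rintro (_ | a | a | a | _) hw
    · exact absurd rfl hw
    -- The vertex `j2 a` covers both outer copies except at `a`: there one vertex is deleted and the
    -- other is matched to `j3 (mate a)`. Since `c ≠ mate a`, the two outer vertices together cover
    -- the middle copy.
    · obtain ⟨c, hca, hcm⟩ := exists_ne_mate ht a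
      have hma := mate_ne a
      refine .inr ⟨{j1 c, j2 a, j3 (mate a)}, Finset.card_le_three, by simp [-Prod.exists]; grind, by simp, ?_⟩
      rintro (_ | p | p | p | _) hs
      · exact dominated_left.2 (by simp [-Prod.exists])
      · refine dominated_j1.2 ?_
        simp [-Prod.exists]; grind
      · refine dominated_j2.2 ?_
        simp [-Prod.exists]; grind
      · refine dominated_j3.2 ?_
        simp [-Prod.exists]; grind
      · exact dominated_right.2 (by simp [-Prod.exists])
    · have hma := mate_ne a
      refine .inl ⟨{left, j3 a, j2 (mate a)}, Finset.card_le_three, by simp [-Prod.exists]; grind, by simp, ?_⟩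
      rintro (_ | p | p | p | _) hs hs'
      · exact absurd rfl hs'
      · exact dominated_j1.2 (by simp [-Prod.exists])
      · refine dominated_j2.2 ?_
        simp [-Prod.exists]; grind
      · refine dominated_j3.2 ?_
        simp [-Prod.exists]; grind [eq_mate_comm]
      · exact dominated_right.2 (by simp [-Prod.exists])
    · obtain ⟨c, hca, hcm⟩ := exists_ne_mate ht a
      refine .inl ⟨{left, j2 a, j3 c}, Finset.card_le_three, by simp [-Prod.exists]; grind, by simp, ?_⟩
      rintro (_ | p | p | p | _) hs hs'
      · exact absurd rfl hs'
      · exact dominated_j1.2 (by simp [-Prod.exists])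
      · refine dominated_j2.2 ?_
        simp [-Prod.exists]; grind [eq_mate_comm]
      · refine dominated_j3.2 ?_
        simp [-Prod.exists]; grind
      · exact dominated_right.2 (by simp [-Prod.exists])
    · refine .inl ⟨{left, j2 o, j2 o'}, Finset.card_le_three, by simp, by simp, ?_⟩
      rintro (_ | p | p | p | _) hs hs'
      · exact absurd rfl hs'
      · exact dominated_j1.2 (by simp [-Prod.exists])
      · refine dominated_j2.2 ?_
        simp [-Prod.exists]; grind [eq_mate_comm, mate_mate]
      · refine dominated_j3.2 ?_
        simp [-Prod.exists]; grind
      · exact absurd rfl hs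
  · rintro (_ | p | p | p | _)
    · exact .refl _ _ _
    · exact (hj₁ p).mono (by simp)
    · exact (hj₂ p).mono (by simp)
    · exact (hj₃ p).mono (by simp)
    · exact (hj₃ o).snoc (by simp [JRel])
  · rintro (_ | p | p | p | _) hs
    · exact .refl _ _ _
    · exact (hj₁ p).mono (by simp)
    · exact (hj₂ p).mono (by simp)
    · exact hj₃ p
    · exact absurd rfl hs
  · refine ⟨fun s => match s with
      | .left => 0 | .j1 _ => 1 | .j2 _ => 2 | .j3 _ => 3 | .right => 4, rfl, rfl, ?_⟩
    rintro (_ | p | p | p | _) (_ | q | q | q | _) h <;> simp [JRel] at h ⊢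

/-! ### Criticality and diameter -/

lemma totalDominationNumber_le {V : Type*} {G : SimpleGraph V} {S : Finset V}
    (h : IsTotalDominatingSet G S) : totalDominationNumber G ≤ S.card :=
  iInf₂_le S h

lemma exists_pair_of_totalDominationNumber_eq_two {V : Type*} {G : SimpleGraph V}
    (h : totalDominationNumber G = 2) : ∃ a b, a ≠ b ∧ ∀ w, G.Adj w a ∨ G.Adj w b := by
  classical
  obtain ⟨S, hS, hlt⟩ : ∃ S, ∃ _ : IsTotalDominatingSet G S, (S.card : ℕ∞) < 3 := by
    -- An infimum below 3 exhibits a set of size below 3, so it need not be shown separately that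
    -- the minimum is attained.
    have h3 : totalDominationNumber G < 3 := by rw [h]; norm_num
    simpa only [totalDominationNumber, iInf_lt_iff] using h3
  have hle := totalDominationNumber_le hS
  rw [h] at hle
  have hcard : S.card = 2 := by
    have h₁ : 2 ≤ S.card := by exact_mod_cast hle
    have h₂ : S.card < 3 := by exact_mod_cast hlt
    lia
  obtain ⟨a, b, hab, rfl⟩ := Finset.card_eq_two.1 hcard
  exact ⟨a, b, hab, fun w => by simpa using hS w⟩

/-- A graph in which total dominating sets have more than `k` vertices, while at most `k` vertices
suffice after the removal of any vertex, is vertex-critical. -/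
lemma isTotalDominationVertexCritical_of_delete {V : Type*} [Nontrivial V] {G : SimpleGraph V}
    {k : ℕ} (hle : ∀ S, IsTotalDominatingSet G S → k + 1 ≤ S.card)
    (hdel : ∀ w, ∃ S : Finset V, S.card ≤ k ∧ w ∉ S ∧ ∀ x, x ≠ w → IsTotallyDominated G S x) :
    IsTotalDominationVertexCritical G (k + 1) ∧
      ∀ w, ∃ S, IsTotalDominatingSet (deleteVertex G w) S ∧ S.card = k := by
  classical
  -- Deleting some other vertex leaves `w` dominated, so `w` is not isolated.
  have hadj (w : V) : ∃ x, G.Adj w x := by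
    obtain ⟨w', hw'⟩ := exists_ne w
    obtain ⟨S, -, -, hS⟩ := hdel w'
    obtain ⟨s, -, hs⟩ := hS w hw'.symm
    exact ⟨s, hs⟩
  have hins {w x : V} {S : Finset V} (hwx : G.Adj w x)
      (hS : ∀ y, y ≠ w → IsTotallyDominated G S y) : IsTotalDominatingSet G (insert x S) := by
    intro y
    by_cases hy : y = w
    · exact ⟨x, Finset.mem_insert_self _ _, hy ▸ hwx⟩
    · obtain ⟨s, hs, h⟩ := hS y hy
      exact ⟨s, Finset.mem_insert_of_mem hs, h⟩
  have hexact (w : V) : ∃ S, IsTotalDominatingSet (deleteVertex G w) S ∧ S.card = k := by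
    obtain ⟨S, hc, hw, hS⟩ := hdel w
    have hwS : ∀ x ∈ S, x ∈ ({w}ᶜ : Set V) := fun x hx hxw => hw (hxw ▸ hx)
    refine ⟨S.subtype (· ∈ ({w}ᶜ : Set V)), fun y => ?_, ?_⟩
    · obtain ⟨s, hs, h⟩ := hS y.1 y.2
      exact ⟨⟨s, hwS s hs⟩, Finset.mem_subtype.2 hs, h⟩
    -- Adding a neighbour of `w` gives a total dominating set of the whole graph, which has at least
    -- `k + 1` vertices; so the size is exactly `k`.
    · obtain ⟨x, hx⟩ := hadj w
      have h₁ := hle _ (hins hx hS)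
      have h₂ := Finset.card_insert_le x S
      rw [Finset.card_subtype, Finset.filter_true_of_mem hwS]
      lia
  have hnum : totalDominationNumber G = (k + 1 : ℕ) := by
    refine le_antisymm ?_ (le_iInf₂ fun S hS => by exact_mod_cast hle S hS)
    obtain ⟨w⟩ : Nonempty V := inferInstance
    obtain ⟨x, hx⟩ := hadj w
    obtain ⟨S, hc, -, hS⟩ := hdel w
    refine (totalDominationNumber_le (hins hx hS)).trans ?_
    exact_mod_cast (Finset.card_insert_le x S).trans (by lia)
  refine ⟨⟨hnum, fun w _ => ?_⟩, hexact⟩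
  obtain ⟨S, hS, hc⟩ := hexact w
  rw [hnum]
  refine (totalDominationNumber_le hS).trans_lt ?_
  rw [hc]
  exact_mod_cast Nat.lt_succ_self k

/-- A pointed graph with a level function, in which all distances are at most the level of
Right. -/
lemma PointedGraph.isDiametrical_of_level {G : PointedGraph.{u}} {d : ℕ}
    (hw : ∀ x y, WalkWithin G.graph d x y)
    (hℓ : ∃ ℓ : G.V → ℕ, ℓ G.left = 0 ∧ ℓ G.right = d ∧
      ∀ x y, G.graph.Adj x y → ℓ y ≤ ℓ x + 1) :
    G.IsDiametrical ∧ G.graph.diam = d := by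
  obtain ⟨ℓ, h₀, h₁, hℓ⟩ := hℓ
  have : Nonempty G.V := ⟨G.left⟩
  have hle : G.graph.ediam ≤ d := SimpleGraph.ediam_le_of_edist_le fun x y => by
    obtain ⟨p, hp⟩ := hw x y
    exact p.edist_le.trans (by exact_mod_cast hp)
  -- Finiteness excludes the default value 0 of `diam` for an infinite extended diameter, and yields
  -- connectedness.
  have hne : G.graph.ediam ≠ ⊤ := ne_top_of_le_ne_top (ENat.natCast_ne_top d) hle
  have hconn := SimpleGraph.connected_of_ediam_ne_top hne
  have hdist : d ≤ G.graph.dist G.left G.right := by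
    obtain ⟨p, hp⟩ := hconn.exists_walk_length_eq_dist G.left G.right
    have := level_le_add_length hℓ p
    lia
  have hdiam : G.graph.diam ≤ d := ENat.toNat_le_of_le_natCast hle
  have := SimpleGraph.dist_le_diam hne (u := G.left) (v := G.right)
  exact ⟨⟨hconn, by lia⟩, by lia⟩

theorem mainTheorem6 {W : Type*} [Finite W] (H : SimpleGraph W) (hW : 4 ≤ Nat.card W)
    (hH : totalDominationNumber H = 2) (hHc : totalDominationNumber Hᶜ = 2)
    (m t : ℕ) (hm : 2 ≤ m) (ht : 2 ≤ t) (n : ℕ) :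
    IsTotalDominationVertexCritical (graphRQJ m H t n).graph (3 * n + 6) ∧
      (graphRQJ m H t n).IsDiametrical ∧
      (graphRQJ m H t n).graph.diam = 5 * n + 7 ∧
      ∀ v, ∃ S, IsTotalDominatingSet (deleteVertex (graphRQJ m H t n).graph v) S ∧
        S.card = 3 * n + 5 := by
  have : Nonempty W := (Nat.card_pos_iff.1 (by lia)).1
  have hP := (graphR_isChainPrefix hm).glue_pow (graphQ_isChainLink
    (exists_pair_of_totalDominationNumber_eq_two hH)
    (exists_pair_of_totalDominationNumber_eq_two hHc)) n
  have hJ := graphJ_isChainEnd ht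
  have hlevel := PointedGraph.glue_exists_level hP.exists_level hJ.exists_level
  have hdiam := PointedGraph.isDiametrical_of_level (hP.glue_end_walk hJ) hlevel
  have : Nontrivial (graphRQJ m H t n).V := by
    obtain ⟨ℓ, h₀, h₁, -⟩ := hlevel
    refine ⟨(graphRQJ m H t n).left, (graphRQJ m H t n).right, fun h => ?_⟩
    exact absurd (h₀.symm.trans ((congrArg ℓ h).trans h₁)) (by lia)
  have hcrit := isTotalDominationVertexCritical_of_delete (G := (graphRQJ m H t n).graph)
    (hP.glue_end_le_card hJ) (hP.glue_end_exists_delete hJ)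
  exact ⟨hcrit.1, hdiam.1, hdiam.2, hcrit.2⟩
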